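/- Let $\mathcal P(\mathbb R)$ be the space of Borel probability measures on $\mathbb R$ with the (metrizable) topology of weak convergence and its Borel $\sigma$-algebra. For $\beta>0$ and an integer $N\ge 1$ let $$Q_\beta^N(d\lambda_1,\dots,d\lambda_N)=\frac1{Z_\beta^N}\prod_{1\le i<j\le N}|\lambda_i-\lambda_j|^\beta\,\exp\Big(-\frac N2\sum_{i=1}^N\lambda_i^2\Big)\prod_{i=1}^N d\lambda_i$$ be the $\beta$-Hermite ensemble on $\mathbb R^N$, where $Z_\beta^N$ is the normalizing constant making it a probability measure, and let $Q_\beta^N$ also denote its push-forward to $\mathcal P(\mathbb R)$ under the empirical measure map $(\lambda_1,\dots,\lambda_N)\mapsto\frac1N\sum_{i=1}^N\delta_{\lambda_i}$. For $\mu\in\mathcal P(\mathbb R)$ put $$H_\beta(\mu)=\frac12\iint f_\beta(x,y)\,\mu(dx)\,\mu(dy)\in\,]-\infty,+\infty],\qquad I_\beta(\mu)=H_\beta(\mu)-\inf_{\nu\in\mathcal P(\mathbb R)}H_\beta(\nu),$$ where $f_\beta(x,y)=\frac{x^2+y^2}2-\beta\log|x-y|$ if $x\ne y$ and $f_\beta(x,x)=+\infty$.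 **Theorem.** For every $\beta>0$ the sequence $(Q_\beta^N)_{N\ge1}$ satisfies a large deviations principle on $\mathcal P(\mathbb R)$ at speed $N^2$ with good rate function $I_\beta$. That is, $I_\beta$ is lower semicontinuous with values in $]-\infty,+\infty]$, the set $\{I_\beta\le M\}$ is compact for every $M\in\mathbb R$, and for every Borel set $E\subset\mathcal P(\mathbb R)$ $$-\inf_{\mu\in\mathring E}I_\beta(\mu)\le\liminf_{N\to\infty}\frac1{N^2}\log Q_\beta^N(\mathring E)\le\limsup_{N\to\infty}\frac1{N^2}\log Q_\beta^N(\overline E)\le-\inf_{\mu\in\overline E}I_\beta(\mu),$$ with the conventions $\log 0=-\infty$ and $\inf\emptyset=+\infty$. -/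

import Mathlib

open MeasureTheory Filter Topology

noncomputable section

namespace LargeDeviations

/-- A good rate function `I : X → ]-∞, +∞]`: it never takes the value `-∞`, it is lower
semicontinuous, and its sub-level sets at all real levels are compact. -/
structure IsGoodRateFunction {X : Type*} [TopologicalSpace X] (I : X → EReal) : Prop where
  ne_bot : ∀ x, I x ≠ ⊥
  lowerSemicontinuous : LowerSemicontinuous I
  isCompact_sublevel : ∀ M : ℝ, IsCompact {x | I x ≤ (M : EReal)}

/-- The (full) large deviations principle for a sequence `(P N)`, `N ≥ 1`, of Borel probability
measures on `X`, at speed `a N` and with good rate function `I`. The measures live on the Borel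
`σ`-algebra `borel X`; logarithms and infima take values in `[-∞, +∞]`, with `log 0 = -∞` and
`inf ∅ = +∞`. -/
structure SatisfiesLDP {X : Type*} [TopologicalSpace X]
    (P : ℕ+ → @Measure X (borel X)) (a : ℕ+ → ℝ) (I : X → EReal) : Prop where
  isProbabilityMeasure : ∀ N, @IsProbabilityMeasure X (borel X) (P N)
  speed_pos : ∀ N, 0 < a N
  speed_tendsto : Tendsto a atTop atTop
  isGoodRateFunction : IsGoodRateFunction I
  bounds : ∀ E : Set X, MeasurableSet[borel X] E →
    -(⨅ x ∈ interior E, I x)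
        ≤ liminf (fun N => (((a N)⁻¹ : ℝ) : EReal) * ENNReal.log (P N (interior E))) atTop ∧
    liminf (fun N => (((a N)⁻¹ : ℝ) : EReal) * ENNReal.log (P N (interior E))) atTop
        ≤ limsup (fun N => (((a N)⁻¹ : ℝ) : EReal) * ENNReal.log (P N (closure E))) atTop ∧
    limsup (fun N => (((a N)⁻¹ : ℝ) : EReal) * ENNReal.log (P N (closure E))) atTop
        ≤ -(⨅ x ∈ closure E, I x)

end LargeDeviations

namespace BetaHermite

/-- The unnormalized density `∏_{i<j} |xᵢ - xⱼ|^β * exp (-(N/2) ∑ xᵢ²)` on `ℝ^N`. -/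
def density (β : ℝ) (N : ℕ+) (x : Fin N → ℝ) : ℝ :=
  (∏ i : Fin N, ∏ j ∈ Finset.Ioi i, |x i - x j| ^ β) *
    Real.exp (-(1 / 2) * (N : ℝ) * ∑ i : Fin N, x i ^ 2)

/-- The unnormalized measure with the above density with respect to Lebesgue measure. -/
def unnormalizedMeasure (β : ℝ) (N : ℕ+) : Measure (Fin N → ℝ) :=
  volume.withDensity fun x => ENNReal.ofReal (density β N x)

/-- The normalizing constant `Z_β^N`, the total mass of the unnormalized measure. -/
def partitionFunction (β : ℝ) (N : ℕ+) : ENNReal :=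
  unnormalizedMeasure β N Set.univ

/-- The `β`-Hermite ensemble on `ℝ^N`. -/
def ensemble (β : ℝ) (N : ℕ+) : Measure (Fin N → ℝ) :=
  (partitionFunction β N)⁻¹ • unnormalizedMeasure β N

/-- The empirical measure `(1/N) ∑ᵢ δ_{xᵢ}`. -/
def empiricalMeasure (N : ℕ+) (x : Fin N → ℝ) : ProbabilityMeasure ℝ :=
  ⟨((N : ℕ) : ENNReal)⁻¹ • ∑ i : Fin N, Measure.dirac (x i), ⟨by
    simp [ENNReal.inv_mul_cancel]⟩⟩

theorem continuous_empiricalMeasure (N : ℕ+) : Continuous (empiricalMeasure N) := by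
  rw [continuous_iff_continuousAt]
  intro x
  refine ProbabilityMeasure.tendsto_iff_forall_integral_tendsto.2 fun f => ?_
  have key : ∀ y : Fin N → ℝ, ∫ t, f t ∂(empiricalMeasure N y : Measure ℝ)
      = ((N : ℕ) : ℝ)⁻¹ * ∑ i, f (y i) := by
    intro y
    simp only [empiricalMeasure, ProbabilityMeasure.coe_mk]
    rw [integral_smul_measure, integral_finsetSum_measure]
    · simp
    · intro i _
      exact f.integrable _
  simp only [key]
  exact Continuous.tendsto (by fun_prop) x

/-- The law of the empirical measure under the `β`-Hermite ensemble: the push-forward of the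
ensemble to the space of probability measures on `ℝ` with the Borel `σ`-algebra of the weak
topology (the map `empiricalMeasure N` is continuous, hence Borel measurable). -/
def law (β : ℝ) (N : ℕ+) :
    @Measure (ProbabilityMeasure ℝ) (borel (ProbabilityMeasure ℝ)) :=
  @Measure.map (Fin N → ℝ) (ProbabilityMeasure ℝ) _ (borel (ProbabilityMeasure ℝ))
    (empiricalMeasure N) (ensemble β N)

/-- The interaction `f_β(x, y) = (x² + y²)/2 - β log |x - y|` off the diagonal, `+∞` on it. -/
def interaction (β : ℝ) (z : ℝ × ℝ) : EReal :=
  if z.1 = z.2 then ⊤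
  else (((z.1 ^ 2 + z.2 ^ 2) / 2 - β * Real.log |z.1 - z.2| : ℝ) : EReal)

/-- The integral `∫ f⁺ - ∫ f⁻` of an extended real valued function. (It is used for functions
that are bounded below and finite measures, so that `∫ f⁻ < ∞`.) -/
def extendedIntegral {α : Type*} [MeasurableSpace α] (μ : Measure α) (f : α → EReal) : EReal :=
  ((∫⁻ z, (f z).toENNReal ∂μ : ENNReal) : EReal) - ((∫⁻ z, (-f z).toENNReal ∂μ : ENNReal) : EReal)

/-- The energy `H_β(μ) = (1/2) ∬ f_β(x, y) μ(dx) μ(dy)`. -/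
def energy (β : ℝ) (μ : ProbabilityMeasure ℝ) : EReal :=
  ((1 / 2 : ℝ) : EReal) *
    extendedIntegral ((μ : Measure ℝ).prod (μ : Measure ℝ)) (interaction β)

/-- The rate function `I_β = H_β - inf H_β`. -/
def rateFunction (β : ℝ) (μ : ProbabilityMeasure ℝ) : EReal :=
  energy β μ - ⨅ ν : ProbabilityMeasure ℝ, energy β ν

end BetaHermite

end

/-!
The `β`-Hermite density on `ℝ^N` is, up to terms of order `N`, the exponential of
`-(1/2) ∑_{i ≠ j} f_β(xᵢ, xⱼ)`, that is of `-N² H_β` at the empirical measure, except that the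
diagonal has to be left out because `f_β = +∞` there. Lebesgue measure contributes only
`exp (O(N log N))`, so nothing but the energy survives at speed `N²`. Since the normalizing
constant is the mass of the whole space, it suffices to estimate the unnormalized measures; the
bounds on them for the whole space give `N⁻² log Z_β^N → -inf H_β`.

Adding `2 β²` makes `f_β` nonnegative and even at least `(x² + y²) / 4`. Hence the sub-level sets of
the energy have bounded second moments, and are compact by Prokhorov's theorem
(`isCompact_setOf_shiftedEnergy_le`). The shifted interaction is an increasing limit of continuous
functions, so the energy is lower semicontinuous (`lowerSemicontinuous_shiftedEnergy`).

Upper bound. The truncated interactions are finite on the diagonal, at a cost linear in `N`, so the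
density is bounded by the exponential of `-(N² / 2)` times the truncated energy of the empirical
measure, times an integrable Gaussian (`density_le`, `unnormalizedMeasure_le`). The truncations keep
part of the quadratic confinement, so their sub-level sets are already compact; therefore a lower
bound for the energy on a closed set passes to some truncation
(`exists_forall_lt_truncatedEnergy`), and exponential tightness is not needed.

Lower bound. Let `μ` have finite energy and lie in the open set `O`. An i.i.d. sample of `μ` is
close to `μ` by the law of large numbers, and its mean off-diagonal energy is `N (N - 1)` times that
of `μ`, so some configuration `y` has both an empirical measure in `O` and almost the energy of `μ`
(`eventually_exists_configuration`). Shifting each `yᵢ` to the right by an amount in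
`[r, r + 1] / N²`, with `r` the rank of `yᵢ`, increases all mutual distances and moves points by at
most `1 / N`. This box of volume `N ^ (-2 N)` on which the density is controlled is enough at speed
`N²` (`le_unnormalizedMeasure`, `exp_le_unnormalizedMeasure`). No regularization of `μ` is needed.
-/

namespace BetaHermite

/-! ### The shifted interaction and its truncations -/

/-- The interaction `f_β` shifted by `2 β²`, which makes it nonnegative. -/
noncomputable def shiftedInteraction (β : ℝ) (z : ℝ × ℝ) : ENNReal :=
  if z.1 = z.2 then ⊤
  else ENNReal.ofReal ((z.1 ^ 2 + z.2 ^ 2) / 2 - β * Real.log |z.1 - z.2| + 2 * β ^ 2)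

/-- Continuous truncations increasing to `shiftedInteraction`. A quarter of the quadratic part is
kept out of the truncation so that every level still controls second moments, while only half of
the confinement `x²` is left on the diagonal. -/
noncomputable def truncatedInteraction (β : ℝ) (m : ℕ) (z : ℝ × ℝ) : ℝ :=
  (z.1 ^ 2 + z.2 ^ 2) / 4 + min (m : ℝ)
    ((z.1 ^ 2 + z.2 ^ 2) / 4 - β * Real.log (max |z.1 - z.2| (Real.exp (-m))) + 2 * β ^ 2)

theorem mul_log_abs_sub_le {β : ℝ} (hβ : 0 < β) (x y : ℝ) :
    β * Real.log |x - y| ≤ (x ^ 2 + y ^ 2) / 4 + 2 * β ^ 2 := by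
  have h1 : Real.log |x - y| ≤ |x - y| := Real.log_le_self (abs_nonneg _)
  have h2 : β * Real.log |x - y| ≤ β * |x - y| := by gcongr
  nlinarith [sq_nonneg (|x - y| - 4 * β), sq_abs (x - y), sq_nonneg (x + y)]

theorem mul_log_max_le {β : ℝ} (hβ : 0 < β) (m : ℕ) (x y : ℝ) :
    β * Real.log (max |x - y| (Real.exp (-m))) ≤ (x ^ 2 + y ^ 2) / 4 + 2 * β ^ 2 := by
  rcases le_total |x - y| (Real.exp (-m)) with h | h
  · rw [max_eq_right h, Real.log_exp]
    have : 0 ≤ β * m := by positivity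
    nlinarith [sq_nonneg x, sq_nonneg y, sq_nonneg β]
  · rw [max_eq_left h]
    exact mul_log_abs_sub_le hβ x y

theorem le_truncatedInteraction {β : ℝ} (hβ : 0 < β) (m : ℕ) (z : ℝ × ℝ) :
    (z.1 ^ 2 + z.2 ^ 2) / 4 ≤ truncatedInteraction β m z := by
  have := mul_log_max_le hβ m z.1 z.2
  have : 0 ≤ min (m : ℝ)
    ((z.1 ^ 2 + z.2 ^ 2) / 4 - β * Real.log (max |z.1 - z.2| (Real.exp (-m))) + 2 * β ^ 2) :=
    le_min (by positivity) (by linarith)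
  unfold truncatedInteraction
  linarith

theorem truncatedInteraction_nonneg {β : ℝ} (hβ : 0 < β) (m : ℕ) (z : ℝ × ℝ) :
    0 ≤ truncatedInteraction β m z :=
  le_trans (by positivity) (le_truncatedInteraction hβ m z)

theorem truncatedInteraction_diag_le (β : ℝ) (m : ℕ) (x : ℝ) :
    truncatedInteraction β m (x, x) ≤ x ^ 2 / 2 + m := by
  unfold truncatedInteraction
  have := min_le_left (m : ℝ)
    ((x ^ 2 + x ^ 2) / 4 - β * Real.log (max |x - x| (Real.exp (-m))) + 2 * β ^ 2)
  simp only at *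
  linarith

theorem truncatedInteraction_swap (β : ℝ) (m : ℕ) (x y : ℝ) :
    truncatedInteraction β m (x, y) = truncatedInteraction β m (y, x) := by
  simp only [truncatedInteraction, abs_sub_comm x y, add_comm (x ^ 2)]

theorem truncatedInteraction_le_of_ne {β : ℝ} (hβ : 0 < β) (m : ℕ) {x y : ℝ} (h : x ≠ y) :
    truncatedInteraction β m (x, y) ≤
      (x ^ 2 + y ^ 2) / 2 - β * Real.log |x - y| + 2 * β ^ 2 := by
  unfold truncatedInteraction
  have h0 : 0 < |x - y| := abs_pos.2 (sub_ne_zero.2 h)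
  have h1 := min_le_right (m : ℝ)
    ((x ^ 2 + y ^ 2) / 4 - β * Real.log (max |x - y| (Real.exp (-m))) + 2 * β ^ 2)
  have h2 : β * Real.log |x - y| ≤ β * Real.log (max |x - y| (Real.exp (-m))) := by
    gcongr
    exact le_max_left _ _
  simp only at *
  linarith

theorem continuous_truncatedInteraction (β : ℝ) (m : ℕ) :
    Continuous (truncatedInteraction β m) := by
  have h : ∀ z : ℝ × ℝ, max |z.1 - z.2| (Real.exp (-m)) ≠ 0 := fun z =>
    (lt_of_lt_of_le (Real.exp_pos _) (le_max_right _ _)).ne'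
  unfold truncatedInteraction
  fun_prop (disch := exact h)

theorem monotone_truncatedInteraction {β : ℝ} (hβ : 0 < β) :
    Monotone (truncatedInteraction β) := by
  intro m n hmn z
  unfold truncatedInteraction
  have hmn' : (m : ℝ) ≤ n := by exact_mod_cast hmn
  gcongr

theorem iSup_truncatedInteraction {β : ℝ} (hβ : 0 < β) (z : ℝ × ℝ) :
    ⨆ m, ENNReal.ofReal (truncatedInteraction β m z) = shiftedInteraction β z := by
  obtain ⟨x, y⟩ := z
  by_cases h : x = y
  · subst h
    simp only [shiftedInteraction, if_true]
    rw [iSup_eq_top]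
    intro b hb
    have hc : 0 < min 1 β := lt_min one_pos hβ
    obtain ⟨m, hm⟩ := exists_nat_gt (b.toReal / min 1 β)
    refine ⟨m, ?_⟩
    rw [ENNReal.lt_ofReal_iff_toReal_lt hb.ne]
    rw [div_lt_iff₀ hc] at hm
    refine hm.trans_le ?_
    have h1 : (m : ℝ) * min 1 β ≤ m := mul_le_of_le_one_right (by positivity) (min_le_left _ _)
    have h2 : (m : ℝ) * min 1 β ≤ m * β := by gcongr; exact min_le_right _ _
    have h3 : (m : ℝ) * min 1 β ≤ min (m : ℝ)
        ((x ^ 2 + x ^ 2) / 4 - β * Real.log (max |x - x| (Real.exp (-m))) + 2 * β ^ 2) := by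
      refine le_min h1 (h2.trans ?_)
      rw [sub_self, abs_zero, max_eq_right (Real.exp_pos _).le, Real.log_exp]
      nlinarith [sq_nonneg x, sq_nonneg β]
    unfold truncatedInteraction
    simp only
    nlinarith [sq_nonneg x]
  · simp only [shiftedInteraction, if_neg h]
    apply le_antisymm
    · exact iSup_le fun m => ENNReal.ofReal_le_ofReal (truncatedInteraction_le_of_ne hβ m h)
    · have h0 : 0 < |x - y| := abs_pos.2 (sub_ne_zero.2 h)
      obtain ⟨m, hm⟩ := exists_nat_ge (max (-Real.log |x - y|)
        ((x ^ 2 + y ^ 2) / 4 - β * Real.log |x - y| + 2 * β ^ 2))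
      refine le_iSup_of_le m (ENNReal.ofReal_le_ofReal (le_of_eq ?_))
      have h1 : Real.exp (-m) ≤ |x - y| := by
        rw [← Real.le_log_iff_exp_le h0]
        linarith [le_max_left (-Real.log |x - y|)
          ((x ^ 2 + y ^ 2) / 4 - β * Real.log |x - y| + 2 * β ^ 2)]
      unfold truncatedInteraction
      simp only
      rw [max_eq_left h1, min_eq_right (le_trans (le_max_right _ _) hm)]
      ring

/-! ### Energies -/

/-- The energy `∬ (f_β + 2 β²) dμ dμ ∈ [0, ∞]`. -/
noncomputable def shiftedEnergy (β : ℝ) (μ : ProbabilityMeasure ℝ) : ENNReal :=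
  ∫⁻ z, shiftedInteraction β z ∂((μ : Measure ℝ).prod (μ : Measure ℝ))

/-- The energy with the truncated interaction. -/
noncomputable def truncatedEnergy (β : ℝ) (m : ℕ) (μ : ProbabilityMeasure ℝ) : ENNReal :=
  ∫⁻ z, ENNReal.ofReal (truncatedInteraction β m z) ∂((μ : Measure ℝ).prod (μ : Measure ℝ))

theorem measurable_shiftedInteraction {β : ℝ} (hβ : 0 < β) :
    Measurable (shiftedInteraction β) := by
  rw [← funext (iSup_truncatedInteraction hβ)]
  exact .iSup fun m => (continuous_truncatedInteraction β m).measurable.ennreal_ofReal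

theorem shiftedEnergy_eq_iSup {β : ℝ} (hβ : 0 < β) (μ : ProbabilityMeasure ℝ) :
    shiftedEnergy β μ = ⨆ m, truncatedEnergy β m μ := by
  unfold shiftedEnergy truncatedEnergy
  rw [← lintegral_iSup
    (fun m => (continuous_truncatedInteraction β m).measurable.ennreal_ofReal)
    (fun m n h z => ENNReal.ofReal_le_ofReal (monotone_truncatedInteraction hβ h z))]
  simp_rw [iSup_truncatedInteraction hβ]

theorem monotone_truncatedEnergy {β : ℝ} (hβ : 0 < β) : Monotone (truncatedEnergy β) :=
  fun _ _ h _ => lintegral_mono fun z =>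
    ENNReal.ofReal_le_ofReal (monotone_truncatedInteraction hβ h z)

/-- The integral of a nonnegative continuous function is a supremum of integrals of bounded
continuous functions, hence weakly lower semicontinuous. -/
theorem lowerSemicontinuous_lintegral_ofReal {X : Type*} [TopologicalSpace X] [MeasurableSpace X]
    [OpensMeasurableSpace X] {g : X → ℝ} (hg : Continuous g) :
    LowerSemicontinuous fun μ : ProbabilityMeasure X =>
      ∫⁻ x, ENNReal.ofReal (g x) ∂(μ : Measure X) := by
  let G : ℕ → BoundedContinuousFunction X NNReal := fun n =>
    .mkOfBound ⟨fun x => min (g x).toNNReal n, by fun_prop⟩ n fun x y => by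
      rw [NNReal.dist_eq, abs_sub_le_iff]
      have hx : ((min (g x).toNNReal n : NNReal) : ℝ) ≤ n := by
        exact_mod_cast min_le_right (g x).toNNReal (n : NNReal)
      have hy : ((min (g y).toNNReal n : NNReal) : ℝ) ≤ n := by
        exact_mod_cast min_le_right (g y).toNNReal (n : NNReal)
      have hx' := (min (g x).toNNReal (n : NNReal)).coe_nonneg
      have hy' := (min (g y).toNNReal (n : NNReal)).coe_nonneg
      exact ⟨(sub_le_self _ hy').trans hx, (sub_le_self _ hx').trans hy⟩
  have key : ∀ μ : ProbabilityMeasure X, ∫⁻ x, ENNReal.ofReal (g x) ∂(μ : Measure X)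
      = ⨆ n, ∫⁻ x, G n x ∂(μ : Measure X) := by
    intro μ
    rw [← lintegral_iSup]
    · congr with x
      apply le_antisymm
      · obtain ⟨n, hn⟩ := exists_nat_ge (g x).toNNReal
        refine le_iSup_of_le n ?_
        simp [G, min_eq_left hn, ENNReal.ofReal]
      · refine iSup_le fun n => ?_
        simp [G, ENNReal.ofReal]
    · exact fun n => (G n).continuous.measurable.coe_nnreal_ennreal
    · intro m n h x
      simp only [G]
      norm_cast
      exact min_le_min le_rfl (by exact_mod_cast h)
  simp_rw [key]
  refine lowerSemicontinuous_iSup fun n => Continuous.lowerSemicontinuous ?_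
  have := ENNReal.continuous_coe.comp
    (ProbabilityMeasure.continuous_testAgainstNN_eval (Ω := X) (G n))
  convert this using 2 with μ
  simp [FiniteMeasure.testAgainstNN_coe_eq]

theorem lowerSemicontinuous_truncatedEnergy (β : ℝ) (m : ℕ) :
    LowerSemicontinuous (truncatedEnergy β m) := by
  have hc : Continuous fun μ : ProbabilityMeasure ℝ => μ.prod μ :=
    ProbabilityMeasure.continuous_prod.comp (continuous_id.prodMk continuous_id)
  exact fun μ a ha => (hc.tendsto μ).eventually
    (lowerSemicontinuous_lintegral_ofReal (continuous_truncatedInteraction β m) (μ.prod μ) a ha)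

theorem lowerSemicontinuous_shiftedEnergy {β : ℝ} (hβ : 0 < β) :
    LowerSemicontinuous (shiftedEnergy β) := by
  rw [funext (shiftedEnergy_eq_iSup hβ)]
  exact lowerSemicontinuous_iSup fun m => lowerSemicontinuous_truncatedEnergy β m

theorem lintegral_sq_le_truncatedEnergy {β : ℝ} (hβ : 0 < β) (m : ℕ) (μ : ProbabilityMeasure ℝ) :
    ∫⁻ x, ENNReal.ofReal (x ^ 2 / 4) ∂(μ : Measure ℝ) ≤ truncatedEnergy β m μ := by
  calc ∫⁻ x, ENNReal.ofReal (x ^ 2 / 4) ∂(μ : Measure ℝ)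
      = ∫⁻ z : ℝ × ℝ, ENNReal.ofReal (z.1 ^ 2 / 4) ∂((μ : Measure ℝ).prod (μ : Measure ℝ)) := by
        rw [lintegral_prod _ (by fun_prop)]
        simp
    _ ≤ _ := lintegral_mono fun z => ENNReal.ofReal_le_ofReal
        (le_trans (by nlinarith [sq_nonneg z.2]) (le_truncatedInteraction hβ m z))

theorem isCompact_setOf_truncatedEnergy_le {β : ℝ} (hβ : 0 < β) (m : ℕ) {A : ENNReal}
    (hA : A ≠ ⊤) : IsCompact {μ | truncatedEnergy β m μ ≤ A} := by
  have hclosed : IsClosed {μ | truncatedEnergy β m μ ≤ A} :=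
    (lowerSemicontinuous_truncatedEnergy β m).isClosed_preimage A
  rw [← hclosed.closure_eq]
  apply isCompact_closure_of_isTightMeasureSet
  apply isTightMeasureSet_of_tendsto_measure_norm_gt
  -- Markov's inequality for the second moment
  have hbound : ∀ r : ℝ, 0 < r → ⨆ ν ∈ {((μ : ProbabilityMeasure ℝ) : Measure ℝ) |
      μ ∈ {μ | truncatedEnergy β m μ ≤ A}}, ν {x | r < ‖x‖} ≤ A / ENNReal.ofReal (r ^ 2 / 4) := by
    intro r hr
    refine iSup₂_le ?_
    rintro _ ⟨μ, hμ, rfl⟩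
    rw [ENNReal.le_div_iff_mul_le (Or.inl (by simpa using by positivity)) (Or.inl (by simp))]
    calc _ = ENNReal.ofReal (r ^ 2 / 4) * (μ : Measure ℝ) {x | r < ‖x‖} := mul_comm _ _
      _ ≤ ENNReal.ofReal (r ^ 2 / 4) * (μ : Measure ℝ)
          {x | ENNReal.ofReal (r ^ 2 / 4) ≤ ENNReal.ofReal (x ^ 2 / 4)} := by
        gcongr with x
        intro hx
        apply ENNReal.ofReal_le_ofReal
        rw [← sq_abs x]
        gcongr
        exact (show r < |x| from hx).le
      _ ≤ _ := mul_meas_ge_le_lintegral₀ (by fun_prop) _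
      _ ≤ _ := lintegral_sq_le_truncatedEnergy hβ m μ
      _ ≤ A := hμ
  have hlim : Tendsto (fun r : ℝ => A / ENNReal.ofReal (r ^ 2 / 4)) atTop (𝓝 0) := by
    have h1 : Tendsto (fun r : ℝ => ENNReal.ofReal (r ^ 2 / 4)) atTop (𝓝 ⊤) :=
      ENNReal.tendsto_ofReal_atTop.comp
        ((tendsto_pow_atTop two_ne_zero).atTop_div_const (by norm_num))
    simpa using ENNReal.Tendsto.const_div h1 (Or.inr hA)
  refine tendsto_of_tendsto_of_tendsto_of_le_of_le' tendsto_const_nhds hlim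
    (Eventually.of_forall fun _ => zero_le) ?_
  filter_upwards [eventually_gt_atTop 0] with r hr using hbound r hr

theorem truncatedEnergy_le_shiftedEnergy {β : ℝ} (hβ : 0 < β) (m : ℕ) (μ : ProbabilityMeasure ℝ) :
    truncatedEnergy β m μ ≤ shiftedEnergy β μ := by
  rw [shiftedEnergy_eq_iSup hβ]
  exact le_iSup (fun m => truncatedEnergy β m μ) m

theorem isCompact_setOf_shiftedEnergy_le {β : ℝ} (hβ : 0 < β) {A : ENNReal}
    (hA : A ≠ ⊤) : IsCompact {μ | shiftedEnergy β μ ≤ A} :=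
  (isCompact_setOf_truncatedEnergy_le hβ 0 hA).of_isClosed_subset
    ((lowerSemicontinuous_shiftedEnergy hβ).isClosed_preimage A)
    fun μ hμ => (truncatedEnergy_le_shiftedEnergy hβ 0 μ).trans hμ

/-- Minimax for the truncation: on a closed set, a strict lower bound for the energy is already a
strict lower bound for some truncated energy. This is Cantor's intersection theorem for the
sub-level sets of the truncated energies, which are compact and decreasing. -/
theorem exists_forall_lt_truncatedEnergy {β : ℝ} (hβ : 0 < β) {F : Set (ProbabilityMeasure ℝ)}
    (hF : IsClosed F) {A : ENNReal} (hA : A ≠ ⊤) (h : ∀ μ ∈ F, A < shiftedEnergy β μ) :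
    ∃ m, ∀ μ ∈ F, A < truncatedEnergy β m μ := by
  by_contra! hcon
  have hne : (⋂ m, F ∩ {μ | truncatedEnergy β m μ ≤ A}).Nonempty := by
    apply IsCompact.nonempty_iInter_of_sequence_nonempty_isCompact_isClosed
    · exact fun m => Set.inter_subset_inter_right _
        fun μ hμ => (monotone_truncatedEnergy hβ m.le_succ μ).trans hμ
    · exact fun m => hcon m
    · exact (isCompact_setOf_truncatedEnergy_le hβ 0 hA).inter_left hF
    · exact fun m => hF.inter ((lowerSemicontinuous_truncatedEnergy β m).isClosed_preimage A)
  obtain ⟨μ, hμ⟩ := hne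
  rw [Set.mem_iInter] at hμ
  refine (h μ (hμ 0).1).not_ge ?_
  rw [shiftedEnergy_eq_iSup hβ]
  exact iSup_le fun m => (hμ m).2

theorem toENNReal_interaction_add {β : ℝ} (hβ : 0 < β) (z : ℝ × ℝ) :
    (interaction β z).toENNReal + ENNReal.ofReal (2 * β ^ 2) =
      shiftedInteraction β z + (-interaction β z).toENNReal := by
  unfold interaction shiftedInteraction
  split_ifs with h
  · simp
  · have h1 := mul_log_abs_sub_le hβ z.1 z.2
    set v := (z.1 ^ 2 + z.2 ^ 2) / 2 - β * Real.log |z.1 - z.2|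
    have hv : 0 ≤ v + 2 * β ^ 2 := by
      have : 0 ≤ (z.1 ^ 2 + z.2 ^ 2) / 4 := by positivity
      simp only [v]
      linarith
    rw [← EReal.coe_neg, EReal.toENNReal_of_ne_top (by simp), EReal.toENNReal_of_ne_top (by simp),
      EReal.toReal_coe, EReal.toReal_coe]
    rcases le_total 0 v with h0 | h0
    · rw [ENNReal.ofReal_of_nonpos (p := -v) (by linarith), add_zero,
        ENNReal.ofReal_add h0 (by positivity)]
    · rw [ENNReal.ofReal_of_nonpos (p := v) h0, zero_add,
        ← ENNReal.ofReal_add hv (by linarith)]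
      congr 1
      ring

theorem neg_interaction_le {β : ℝ} (hβ : 0 < β) (z : ℝ × ℝ) :
    (-interaction β z).toENNReal ≤ ENNReal.ofReal (2 * β ^ 2) := by
  unfold interaction
  split_ifs with h
  · simp
  · have h1 := mul_log_abs_sub_le hβ z.1 z.2
    have : 0 ≤ (z.1 ^ 2 + z.2 ^ 2) / 4 := by positivity
    rw [← EReal.coe_neg, EReal.toENNReal_of_ne_top (EReal.coe_ne_top _), EReal.toReal_coe]
    exact ENNReal.ofReal_le_ofReal (by linarith)

/-- The energy `H_β` is an affine function of the nonnegative energy `shiftedEnergy`. -/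
theorem energy_eq {β : ℝ} (hβ : 0 < β) (μ : ProbabilityMeasure ℝ) :
    energy β μ = ((1 / 2 : ℝ) : EReal) *
      ((shiftedEnergy β μ : EReal) - ((2 * β ^ 2 : ℝ) : EReal)) := by
  unfold energy extendedIntegral
  congr 1
  set ρ := (μ : Measure ℝ).prod (μ : Measure ℝ)
  have h1 : ∫⁻ z, (interaction β z).toENNReal ∂ρ + ENNReal.ofReal (2 * β ^ 2) =
      shiftedEnergy β μ + ∫⁻ z, (-interaction β z).toENNReal ∂ρ := by
    have := lintegral_congr (μ := ρ) (toENNReal_interaction_add hβ)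
    rw [lintegral_add_right _ measurable_const,
      lintegral_add_left (measurable_shiftedInteraction hβ)] at this
    simp only [lintegral_const, measure_univ, mul_one] at this
    exact this
  have h2 : ∫⁻ z, (-interaction β z).toENNReal ∂ρ ≤ ENNReal.ofReal (2 * β ^ 2) := by
    calc _ ≤ ∫⁻ z, ENNReal.ofReal (2 * β ^ 2) ∂ρ := lintegral_mono (neg_interaction_le hβ)
      _ = _ := by simp [ρ]
  have h3 := (h2.trans_lt ENNReal.ofReal_lt_top).ne
  generalize ∫⁻ z, (interaction β z).toENNReal ∂ρ = p at *
  generalize ∫⁻ z, (-interaction β z).toENNReal ∂ρ = q at *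
  generalize shiftedEnergy β μ = J at *
  lift q to NNReal using h3
  have hC : 0 ≤ 2 * β ^ 2 := by positivity
  induction J with
  | top =>
    have : p = ⊤ := by
      by_contra hp
      exact (ENNReal.add_lt_top.2 ⟨lt_top_iff_ne_top.2 hp, ENNReal.ofReal_lt_top⟩).ne
        (h1.trans (top_add _))
    subst this
    rw [EReal.coe_ennreal_top, EReal.top_sub_coe]
    exact EReal.top_sub_coe (q : ℝ)
  | coe J =>
    have : p ≠ ⊤ := fun hp => by
      rw [hp, top_add] at h1
      exact ENNReal.add_ne_top.2 ⟨ENNReal.coe_ne_top, ENNReal.coe_ne_top⟩ h1.symm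
    lift p to NNReal using this
    have h4 : (p : ℝ) + 2 * β ^ 2 = J + q := by
      have := congrArg ENNReal.toReal h1
      rwa [ENNReal.toReal_add ENNReal.coe_ne_top ENNReal.ofReal_ne_top,
        ENNReal.toReal_add ENNReal.coe_ne_top ENNReal.coe_ne_top,
        ENNReal.toReal_ofReal hC] at this
    have h5 : ((p : ℝ) : EReal) - ((q : ℝ) : EReal) =
        ((J : ℝ) : EReal) - ((2 * β ^ 2 : ℝ) : EReal) := by
      rw [← EReal.coe_sub, ← EReal.coe_sub]
      congr 1
      linarith
    exact h5

/-- The uniform law on `[0, 1]` has finite energy. -/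
theorem exists_shiftedEnergy_ne_top {β : ℝ} (hβ : 0 < β) :
    ∃ μ : ProbabilityMeasure ℝ, shiftedEnergy β μ ≠ ⊤ := by
  let ν : Measure ℝ := volume.restrict (Set.Icc 0 1)
  have hν : IsProbabilityMeasure ν := ⟨by simp [ν]⟩
  refine ⟨⟨ν, hν⟩, ?_⟩
  let g : ℝ → ENNReal := (Set.Icc (-1 : ℝ) 1).indicator fun t =>
    ENNReal.ofReal (1 + 2 * β ^ 2 + β * |Real.log t|)
  have hg : ∫⁻ t, g t ≠ ⊤ := by
    rw [lintegral_indicator measurableSet_Icc]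
    have h1 : IntegrableOn Real.log (Set.Icc (-1 : ℝ) 1) := by
      rw [← intervalIntegrable_iff_integrableOn_Icc_of_le (by norm_num)]
      exact intervalIntegral.intervalIntegrable_log'
    have h2 : IntegrableOn (fun t => 1 + 2 * β ^ 2 + β * |Real.log t|) (Set.Icc (-1 : ℝ) 1) :=
      (integrable_const _).add (h1.abs.const_mul β)
    exact h2.lintegral_lt_top.ne
  have hle : shiftedEnergy β ⟨ν, hν⟩ ≤ ∫⁻ t, g t := by
    change ∫⁻ z, shiftedInteraction β z ∂(ν.prod ν) ≤ _
    rw [lintegral_prod _ (measurable_shiftedInteraction hβ).aemeasurable]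
    calc ∫⁻ x, ∫⁻ y, shiftedInteraction β (x, y) ∂ν ∂ν ≤ ∫⁻ x, ∫⁻ t, g t ∂volume ∂ν := by
          refine setLIntegral_mono' measurableSet_Icc fun x hx => ?_
          calc ∫⁻ y, shiftedInteraction β (x, y) ∂ν ≤ ∫⁻ y, g (x - y) ∂ν := by
                refine lintegral_mono_ae ?_
                have hne : ∀ᵐ y ∂ν, y ≠ x := ae_restrict_of_ae (Measure.ae_ne volume x)
                filter_upwards [hne, ae_restrict_mem measurableSet_Icc] with y hy hy'
                have hmem : x - y ∈ Set.Icc (-1 : ℝ) 1 :=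
                  ⟨by linarith [hx.1, hy'.2], by linarith [hx.2, hy'.1]⟩
                simp only [shiftedInteraction, if_neg hy.symm, g, Set.indicator_of_mem hmem]
                apply ENNReal.ofReal_le_ofReal
                have h1 : -(β * Real.log |x - y|) ≤ β * |Real.log (x - y)| := by
                  rw [Real.log_abs, ← mul_neg]
                  gcongr
                  exact neg_le_abs _
                have h2 : x ^ 2 ≤ 1 := by nlinarith [hx.1, hx.2]
                have h3 : y ^ 2 ≤ 1 := by nlinarith [hy'.1, hy'.2]
                linarith
            _ ≤ ∫⁻ y, g (x - y) := lintegral_mono' Measure.restrict_le_self le_rfl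
            _ = ∫⁻ t, g t := lintegral_sub_left_eq_self g x
      _ = _ := by simp
  exact (hle.trans_lt (lt_top_iff_ne_top.2 hg)).ne

/-! ### The upper bound -/

theorem lintegral_empiricalMeasure (N : ℕ+) (x : Fin N → ℝ) (g : ℝ → ENNReal) :
    ∫⁻ t, g t ∂(empiricalMeasure N x : Measure ℝ) = ((N : ℕ) : ENNReal)⁻¹ * ∑ i, g (x i) := by
  simp [empiricalMeasure, lintegral_finsetSum_measure]

theorem truncatedEnergy_empiricalMeasure {β : ℝ} (hβ : 0 < β) (m : ℕ) (N : ℕ+)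
    (x : Fin N → ℝ) :
    truncatedEnergy β m (empiricalMeasure N x) =
      ENNReal.ofReal ((∑ i, ∑ j, truncatedInteraction β m (x i, x j)) / (N : ℝ) ^ 2) := by
  have hN : (0 : ℝ) < N := by exact_mod_cast N.pos
  have h0 := fun i j => truncatedInteraction_nonneg hβ m (x i, x j)
  unfold truncatedEnergy
  rw [lintegral_prod _
    (continuous_truncatedInteraction β m).measurable.ennreal_ofReal.aemeasurable]
  simp_rw [lintegral_empiricalMeasure]
  rw [← Finset.mul_sum, ← mul_assoc,
    ENNReal.ofReal_div_of_pos (by positivity), ENNReal.ofReal_sum_of_nonneg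
    (fun i _ => Finset.sum_nonneg fun j _ => h0 i j)]
  simp_rw [ENNReal.ofReal_sum_of_nonneg (fun j _ => h0 _ j)]
  rw [ENNReal.ofReal_pow hN.le, ENNReal.ofReal_natCast, div_eq_mul_inv, mul_comm, sq,
    ENNReal.mul_inv (by simp) (by simp)]

/-- Splitting a double sum of a symmetric function along the diagonal. -/
theorem two_mul_sum_sum_Ioi {n : ℕ} (s : Fin n → Fin n → ℝ) (hs : ∀ i j, s i j = s j i) :
    2 * ∑ i, ∑ j ∈ Finset.Ioi i, s i j = ∑ i, ∑ j ∈ {i}ᶜ, s i j := by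
  rw [← Finset.sum_congr rfl fun i _ => Finset.sum_congr rfl fun j _ => hs j i,
    ← Finset.sum_sum_Ioi_add_eq_sum_sum_off_diag, Finset.mul_sum]
  refine Finset.sum_congr rfl fun i _ => ?_
  rw [Finset.mul_sum]
  refine Finset.sum_congr rfl fun j _ => ?_
  rw [hs j i]
  ring

theorem sum_sum_compl {n : ℕ} (s : Fin n → Fin n → ℝ) :
    ∑ i, ∑ j ∈ {i}ᶜ, s i j = ∑ i, ∑ j, s i j - ∑ i, s i i := by
  rw [eq_sub_iff_add_eq, ← Finset.sum_add_distrib]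
  refine Finset.sum_congr rfl fun i _ => ?_
  rw [← Finset.sum_compl_add_sum {i}, Finset.sum_singleton]

theorem sum_sum_half_sq_add {n : ℕ} (x : Fin n → ℝ) (c : ℝ) :
    ∑ i, ∑ j, ((x i ^ 2 + x j ^ 2) / 2 + c) = n * ∑ i, x i ^ 2 + n ^ 2 * c := by
  simp only [Finset.sum_add_distrib, ← Finset.sum_div, Finset.sum_const, Finset.card_univ,
    Fintype.card_fin, nsmul_eq_mul, ← Finset.mul_sum]
  ring

/-- The `N` terms missing on the diagonal of the energy are restored at the cost of `m / 2` for
each point and of half of the confinement `∑ᵢ xᵢ² / 2` that the off-diagonal energy does not use;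
the other half remains for integrability. -/
theorem density_le {β : ℝ} (hβ : 0 < β) (m : ℕ) (N : ℕ+) (x : Fin N → ℝ) :
    density β N x ≤ Real.exp (-(1 / 2) * ∑ i, ∑ j, truncatedInteraction β m (x i, x j)
      + β ^ 2 * (N : ℝ) ^ 2 + N * m / 2) * Real.exp (-(1 / 4) * ∑ i, x i ^ 2) := by
  let W : Fin N → Fin N → ℝ := fun i j =>
    (x i ^ 2 + x j ^ 2) / 2 + 2 * β ^ 2 - truncatedInteraction β m (x i, x j)
  have hW : ∀ i j, W i j = W j i := fun i j => by
    simp only [W, truncatedInteraction_swap β m (x i), add_comm (x i ^ 2)]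
  have hpair : ∀ i j, |x i - x j| ^ β ≤ Real.exp (W i j) := by
    intro i j
    by_cases h : x i = x j
    · rw [h, sub_self, abs_zero, Real.zero_rpow hβ.ne']
      positivity
    · rw [Real.rpow_def_of_pos (abs_pos.2 (sub_ne_zero.2 h))]
      apply Real.exp_le_exp.2
      have := truncatedInteraction_le_of_ne hβ m h
      simp only [W]
      linarith
  have hprod : ∏ i, ∏ j ∈ Finset.Ioi i, |x i - x j| ^ β
      ≤ Real.exp (∑ i, ∑ j ∈ Finset.Ioi i, W i j) := by
    simp only [Real.exp_sum]
    exact Finset.prod_le_prod (fun i _ => Finset.prod_nonneg fun j _ => by positivity)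
      fun i _ => Finset.prod_le_prod (fun j _ => by positivity) fun j _ => hpair i j
  have hsum : 2 * ∑ i, ∑ j ∈ Finset.Ioi i, W i j =
      N * ∑ i, x i ^ 2 + (N : ℝ) ^ 2 * (2 * β ^ 2)
        - ∑ i, ∑ j, truncatedInteraction β m (x i, x j) - ∑ i, W i i := by
    rw [two_mul_sum_sum_Ioi W hW, sum_sum_compl]
    simp only [W, Finset.sum_sub_distrib]
    rw [sum_sum_half_sq_add]
  have hdiag : (1 / 2) * ∑ i, x i ^ 2 - N * m ≤ ∑ i, W i i := by
    calc (1 / 2) * ∑ i, x i ^ 2 - N * m = ∑ i, ((1 / 2) * x i ^ 2 - m) := by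
          simp [Finset.sum_sub_distrib, Finset.mul_sum]
      _ ≤ _ := Finset.sum_le_sum fun i _ => by
          have := truncatedInteraction_diag_le β m (x i)
          simp only [W]
          nlinarith [sq_nonneg β]
  unfold density
  calc _ ≤ Real.exp (∑ i, ∑ j ∈ Finset.Ioi i, W i j) *
        Real.exp (-(1 / 2) * (N : ℝ) * ∑ i, x i ^ 2) := by gcongr
    _ ≤ _ := by
      rw [← Real.exp_add, ← Real.exp_add]
      apply Real.exp_le_exp.2
      linarith

/-- `∫ exp (-x² / 4) dx`. -/
noncomputable def gaussianMass : ℝ := ∫ x : ℝ, Real.exp (-(1 / 4) * x ^ 2)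

theorem gaussianMass_pos : 0 < gaussianMass := by
  rw [gaussianMass, integral_gaussian]
  positivity

theorem lintegral_gaussian_pi (n : ℕ) :
    ∫⁻ x : Fin n → ℝ, ENNReal.ofReal (Real.exp (-(1 / 4) * ∑ i, x i ^ 2)) =
      ENNReal.ofReal (gaussianMass ^ n) := by
  have hint : Integrable fun x : ℝ => Real.exp (-(1 / 4) * x ^ 2) :=
    integrable_exp_neg_mul_sq (by norm_num)
  have heq : (fun x : Fin n → ℝ => Real.exp (-(1 / 4) * ∑ i, x i ^ 2)) =
      fun x => ∏ i, Real.exp (-(1 / 4) * x i ^ 2) := by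
    ext x
    rw [← Real.exp_sum, Finset.mul_sum]
  rw [← ofReal_integral_eq_lintegral_ofReal]
  · rw [heq, integral_fintype_prod_volume_eq_pow (fun t : ℝ => Real.exp (-(1 / 4) * t ^ 2))]
    simp [gaussianMass]
  · rw [heq]
    exact Integrable.fintype_prod fun _ => hint
  · exact Eventually.of_forall fun x => (Real.exp_pos _).le

theorem unnormalizedMeasure_le {β : ℝ} (hβ : 0 < β) (m : ℕ) (N : ℕ+)
    {F : Set (ProbabilityMeasure ℝ)} (hF : IsClosed F) {A : ℝ}
    (hA : ∀ μ ∈ F, ENNReal.ofReal A ≤ truncatedEnergy β m μ) :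
    unnormalizedMeasure β N (empiricalMeasure N ⁻¹' F) ≤
      ENNReal.ofReal (Real.exp (-(1 / 2) * (A * (N : ℝ) ^ 2) + β ^ 2 * (N : ℝ) ^ 2 + N * m / 2
        + N * Real.log gaussianMass)) := by
  have hN : (0 : ℝ) < N := by exact_mod_cast N.pos
  have hmeas : MeasurableSet (empiricalMeasure N ⁻¹' F) :=
    (hF.preimage (continuous_empiricalMeasure N)).measurableSet
  unfold unnormalizedMeasure
  rw [withDensity_apply _ hmeas]
  set c := Real.exp (-(1 / 2) * (A * (N : ℝ) ^ 2) + β ^ 2 * (N : ℝ) ^ 2 + N * m / 2)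
  calc ∫⁻ x in empiricalMeasure N ⁻¹' F, ENNReal.ofReal (density β N x)
      ≤ ∫⁻ x in empiricalMeasure N ⁻¹' F, ENNReal.ofReal c *
          ENNReal.ofReal (Real.exp (-(1 / 4) * ∑ i, x i ^ 2)) := by
        refine setLIntegral_mono' hmeas fun x hx => ?_
        rw [← ENNReal.ofReal_mul (Real.exp_pos _).le]
        apply ENNReal.ofReal_le_ofReal
        refine (density_le hβ m N x).trans ?_
        have h1 := hA _ hx
        rw [truncatedEnergy_empiricalMeasure hβ, ENNReal.ofReal_le_ofReal_iff (by
          have := fun i j => truncatedInteraction_nonneg hβ m (x i, x j)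
          exact div_nonneg (Finset.sum_nonneg fun i _ => Finset.sum_nonneg fun j _ => this i j)
            (by positivity)), le_div_iff₀ (by positivity)] at h1
        gcongr ?_ * _
        apply Real.exp_le_exp.2
        linarith
    _ ≤ ∫⁻ x : Fin N → ℝ, ENNReal.ofReal c *
          ENNReal.ofReal (Real.exp (-(1 / 4) * ∑ i, x i ^ 2)) :=
        lintegral_mono' Measure.restrict_le_self le_rfl
    _ = _ := by
        rw [lintegral_const_mul _ (by fun_prop), lintegral_gaussian_pi,
          ← ENNReal.ofReal_mul (Real.exp_pos _).le, Real.exp_add _ (N * Real.log gaussianMass),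
          Real.exp_nat_mul, Real.exp_log gaussianMass_pos]

/-! ### Mass near a configuration of distinct points -/

/-- Moving the `i`-th point of a configuration to the right by an amount that increases with its
rank only increases the mutual distances, so the density on a small box of such moves is bounded
below by the repulsion of the original configuration. -/
theorem le_unnormalizedMeasure {β : ℝ} (hβ : 0 < β) (N : ℕ+) {y : Fin N → ℝ}
    {S : Set (Fin N → ℝ)}
    (hS : ∀ x : Fin N → ℝ, (∀ i, |x i - y i| ≤ 1 / (N : ℝ)) → x ∈ S) :
    ENNReal.ofReal ((∏ i : Fin N, ∏ j ∈ Finset.Ioi i, |y i - y j| ^ β) *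
        Real.exp (-(1 / 2) * (N + 1) * ∑ i, y i ^ 2 - (N + 1) / 2) *
        Real.exp (-2 * N * Real.log N)) ≤ unnormalizedMeasure β N S := by
  have hN : (0 : ℝ) < N := by exact_mod_cast N.pos
  -- the rank of the `i`-th point
  let r : Fin N → ℕ := fun i => (Finset.univ.filter fun j => y j < y i).card
  have hr : ∀ i j, y i < y j → r i + 1 ≤ r j := by
    intro i j hij
    apply Finset.card_lt_card
    refine (Finset.ssubset_iff_of_subset fun k hk => ?_).2 ⟨i, by simp [hij], by simp⟩
    simp only [Finset.mem_filter, Finset.mem_univ, true_and] at hk ⊢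
    exact hk.trans hij
  have hrN : ∀ i, r i + 1 ≤ N := by
    intro i
    have : r i < (Finset.univ : Finset (Fin N)).card := by
      apply Finset.card_lt_card
      exact (Finset.ssubset_iff_of_subset (Finset.subset_univ _)).2 ⟨i, by simp, by simp⟩
    simpa using this
  let a : Fin N → ℝ := fun i => y i + r i / (N : ℝ) ^ 2
  let b : Fin N → ℝ := fun i => y i + (r i + 1) / (N : ℝ) ^ 2
  have hbox : ∀ x ∈ Set.Icc a b, ∀ i, 0 ≤ x i - y i ∧ x i - y i ≤ 1 / (N : ℝ) := by
    intro x hx i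
    have h1 : y i + r i / (N : ℝ) ^ 2 ≤ x i := hx.1 i
    have h2 : x i ≤ y i + (r i + 1) / (N : ℝ) ^ 2 := hx.2 i
    have h3 : (r i : ℝ) + 1 ≤ N := by exact_mod_cast hrN i
    have h4 : ((r i : ℝ) + 1) / (N : ℝ) ^ 2 ≤ 1 / N := by
      rw [div_le_div_iff₀ (by positivity) hN]
      nlinarith
    have h5 : 0 ≤ (r i : ℝ) / (N : ℝ) ^ 2 := by positivity
    exact ⟨by linarith, by linarith⟩
  have hlt : ∀ x ∈ Set.Icc a b, ∀ i j, y i < y j → y j - y i ≤ x j - x i := by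
    intro x hx i j hij
    have h1 : y j + r j / (N : ℝ) ^ 2 ≤ x j := hx.1 j
    have h2 : x i ≤ y i + (r i + 1) / (N : ℝ) ^ 2 := hx.2 i
    have h3 : (r i : ℝ) + 1 ≤ r j := by exact_mod_cast hr i j hij
    have h4 : ((r i : ℝ) + 1) / (N : ℝ) ^ 2 ≤ r j / (N : ℝ) ^ 2 := by gcongr
    linarith
  have hdist : ∀ x ∈ Set.Icc a b, ∀ i j, |y i - y j| ≤ |x i - x j| := by
    intro x hx i j
    rcases lt_trichotomy (y i) (y j) with h | h | h
    · rw [abs_sub_comm (y i), abs_sub_comm (x i), abs_of_pos (sub_pos.2 h)]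
      exact (hlt x hx i j h).trans (le_abs_self _)
    · simp [h]
    · rw [abs_of_pos (sub_pos.2 h)]
      exact (hlt x hx j i h).trans (le_abs_self _)
  have hdens : ∀ x ∈ Set.Icc a b, (∏ i : Fin N, ∏ j ∈ Finset.Ioi i, |y i - y j| ^ β) *
      Real.exp (-(1 / 2) * (N + 1) * ∑ i, y i ^ 2 - (N + 1) / 2) ≤ density β N x := by
    intro x hx
    unfold density
    have hprod : ∏ i : Fin N, ∏ j ∈ Finset.Ioi i, |y i - y j| ^ β
        ≤ ∏ i : Fin N, ∏ j ∈ Finset.Ioi i, |x i - x j| ^ β :=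
      Finset.prod_le_prod (fun i _ => Finset.prod_nonneg fun j _ => by positivity)
        fun i _ => Finset.prod_le_prod (fun j _ => by positivity) fun j _ =>
          Real.rpow_le_rpow (abs_nonneg _) (hdist x hx i j) hβ.le
    have hsq : ∑ i, x i ^ 2 ≤ (1 + 1 / (N : ℝ)) * ∑ i, y i ^ 2 + (1 + 1 / (N : ℝ)) := by
      calc ∑ i, x i ^ 2
          ≤ ∑ i, ((1 + 1 / (N : ℝ)) * y i ^ 2 + (1 / (N : ℝ) + (1 / (N : ℝ)) ^ 2)) := by
            refine Finset.sum_le_sum fun i _ => ?_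
            obtain ⟨h1, h2⟩ := hbox x hx i
            have h3 : 0 < 1 / (N : ℝ) := by positivity
            set d := 1 / (N : ℝ)
            set t := x i - y i with ht
            have hx' : x i = y i + t := by rw [ht]; ring
            rw [hx']
            have h4 : y i * t ≤ |y i| * d := by
              calc y i * t ≤ |y i| * t := by gcongr; exact le_abs_self _
                _ ≤ _ := by gcongr
            have h5 : t ^ 2 ≤ d ^ 2 := by gcongr
            have h6 : 2 * |y i| ≤ y i ^ 2 + 1 := by
              nlinarith [sq_nonneg (|y i| - 1), sq_abs (y i)]
            nlinarith
        _ = _ := by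
            rw [Finset.sum_add_distrib, ← Finset.mul_sum]
            simp only [Finset.sum_const, Finset.card_univ, Fintype.card_fin, nsmul_eq_mul]
            field_simp
    have hmul : (1 / 2) * (N : ℝ) * ∑ i, x i ^ 2 ≤
        (1 / 2) * (N + 1) * ∑ i, y i ^ 2 + (N + 1) / 2 := by
      calc (1 / 2) * (N : ℝ) * ∑ i, x i ^ 2
          ≤ (1 / 2) * (N : ℝ) * ((1 + 1 / (N : ℝ)) * ∑ i, y i ^ 2 + (1 + 1 / (N : ℝ))) := by
            gcongr
        _ = _ := by field_simp
    gcongr ?_ * Real.exp ?_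
    linarith
  have hvol : volume (Set.Icc a b) = ENNReal.ofReal (Real.exp (-2 * N * Real.log N)) := by
    rw [Real.volume_Icc_pi]
    have : ∀ i, b i - a i = ((N : ℝ) ^ 2)⁻¹ := fun i => by
      simp only [a, b]
      field_simp
      ring
    simp only [this, Finset.prod_const, Finset.card_univ, Fintype.card_fin]
    rw [← ENNReal.ofReal_pow (by positivity)]
    congr 1
    rw [show -2 * (N : ℝ) * Real.log N = ((N : ℕ) : ℝ) * (-(2 * Real.log N)) by ring,
      Real.exp_nat_mul, Real.exp_neg, mul_comm, Real.exp_mul, Real.exp_log hN]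
    norm_num
  rw [ENNReal.ofReal_mul (mul_nonneg (Finset.prod_nonneg fun i _ => Finset.prod_nonneg
    fun j _ => by positivity) (Real.exp_pos _).le), ← hvol, ← setLIntegral_const]
  calc _ ≤ ∫⁻ x in Set.Icc a b, ENNReal.ofReal (density β N x) :=
        setLIntegral_mono' measurableSet_Icc fun x hx => ENNReal.ofReal_le_ofReal (hdens x hx)
    _ = unnormalizedMeasure β N (Set.Icc a b) := (withDensity_apply _ measurableSet_Icc).symm
    _ ≤ _ := measure_mono fun x hx => hS x fun i => by
        rw [abs_of_nonneg (hbox x hx i).1]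
        exact (hbox x hx i).2

theorem unnormalizedMeasure_univ_pos {β : ℝ} (hβ : 0 < β) (N : ℕ+) :
    0 < unnormalizedMeasure β N Set.univ := by
  have hinj : Function.Injective fun i : Fin N => ((i : ℕ) : ℝ) := fun i j h => by
    simpa [Fin.ext_iff] using h
  refine lt_of_lt_of_le ?_
    (le_unnormalizedMeasure hβ N (y := fun i : Fin N => ((i : ℕ) : ℝ)) (S := Set.univ)
      fun _ _ => trivial)
  rw [ENNReal.ofReal_pos]
  have : 0 < ∏ i : Fin N, ∏ j ∈ Finset.Ioi i, |((i : ℕ) : ℝ) - ((j : ℕ) : ℝ)| ^ β :=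
    Finset.prod_pos fun i _ => Finset.prod_pos fun j hj =>
      Real.rpow_pos_of_pos (abs_pos.2 (sub_ne_zero.2 (hinj.ne (Finset.mem_Ioi.1 hj).ne))) _
  positivity

/-- Configurations whose off-diagonal shifted energy is at most `N² J` carry around them a mass of
at least `exp (-N² (J / 2 - β²))`, up to a factor that is negligible at scale `N²`. -/
theorem exp_le_unnormalizedMeasure {β : ℝ} (hβ : 0 < β) {N : ℕ+} (hN2 : 2 ≤ N) {y : Fin N → ℝ}
    {S : Set (Fin N → ℝ)} (hS : ∀ x : Fin N → ℝ, (∀ i, |x i - y i| ≤ 1 / (N : ℝ)) → x ∈ S)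
    {J : ℝ} (hJ0 : 0 ≤ J)
    (hJ : ∑ i, ∑ j ∈ {i}ᶜ, shiftedInteraction β (y i, y j) ≤ ENNReal.ofReal (J * (N : ℝ) ^ 2)) :
    ENNReal.ofReal (Real.exp ((-(1 / 2) * J + β ^ 2) * (N : ℝ) ^ 2
      - (2 * N * Real.log N + β ^ 2 * N + 4 * J * N + N))) ≤ unnormalizedMeasure β N S := by
  have hN : (2 : ℝ) ≤ N := by exact_mod_cast hN2
  -- coinciding points would make the off-diagonal energy infinite
  have hy : Function.Injective y := by
    intro i j hij
    by_contra hne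
    refine ENNReal.ofReal_ne_top (top_le_iff.1 (le_trans ?_ hJ))
    calc (⊤ : ENNReal) = shiftedInteraction β (y i, y j) := by simp [shiftedInteraction, hij]
      _ ≤ ∑ j ∈ {i}ᶜ, shiftedInteraction β (y i, y j) :=
        Finset.single_le_sum (f := fun j => shiftedInteraction β (y i, y j))
          (fun _ _ => zero_le) (by simpa using Ne.symm hne)
      _ ≤ _ := Finset.single_le_sum (f := fun i => ∑ j ∈ {i}ᶜ, shiftedInteraction β (y i, y j))
          (fun _ _ => zero_le) (Finset.mem_univ i)
  refine le_trans (ENNReal.ofReal_le_ofReal ?_) (le_unnormalizedMeasure hβ N hS)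
  let W : Fin N → Fin N → ℝ := fun i j => β * Real.log |y i - y j|
  let v : Fin N → Fin N → ℝ := fun i j =>
    (y i ^ 2 + y j ^ 2) / 2 - β * Real.log |y i - y j| + 2 * β ^ 2
  have hv : ∀ i j, (y i ^ 2 + y j ^ 2) / 4 ≤ v i j := fun i j => by
    have := mul_log_abs_sub_le hβ (y i) (y j)
    simp only [v]
    linarith
  have hv0 : ∀ i j, 0 ≤ v i j := fun i j => le_trans (by positivity) (hv i j)
  have hV : ∑ i, ∑ j ∈ {i}ᶜ, v i j ≤ J * (N : ℝ) ^ 2 := by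
    rw [← ENNReal.ofReal_le_ofReal_iff (by positivity), ENNReal.ofReal_sum_of_nonneg
      (fun i _ => Finset.sum_nonneg fun j _ => hv0 i j)]
    refine le_trans (le_of_eq ?_) hJ
    refine Finset.sum_congr rfl fun i _ => ?_
    rw [ENNReal.ofReal_sum_of_nonneg (fun j _ => hv0 i j)]
    refine Finset.sum_congr rfl fun j hj => ?_
    have hne : y i ≠ y j := hy.ne (by simpa [eq_comm] using hj)
    simp only [shiftedInteraction, if_neg hne, v]
  have hprod : ∏ i, ∏ j ∈ Finset.Ioi i, |y i - y j| ^ β =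
      Real.exp (∑ i, ∑ j ∈ Finset.Ioi i, W i j) := by
    simp only [Real.exp_sum]
    refine Finset.prod_congr rfl fun i _ => Finset.prod_congr rfl fun j hj => ?_
    rw [Real.rpow_def_of_pos
      (abs_pos.2 (sub_ne_zero.2 (hy.ne (Finset.mem_Ioi.1 hj).ne))), mul_comm]
  have hsq : ∀ c : ℝ, ∑ i, ∑ j ∈ {i}ᶜ, ((y i ^ 2 + y j ^ 2) / 2 + c) =
      (N - 1) * ∑ i, y i ^ 2 + (N : ℝ) * (N - 1) * c := fun c => by
    rw [sum_sum_compl, sum_sum_half_sq_add]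
    simp only [Finset.sum_add_distrib, add_self_div_two, Finset.sum_const, Finset.card_univ,
      Fintype.card_fin, nsmul_eq_mul]
    ring
  have hW : 2 * ∑ i, ∑ j ∈ Finset.Ioi i, W i j =
      (N - 1) * ∑ i, y i ^ 2 + (N : ℝ) * (N - 1) * (2 * β ^ 2) - ∑ i, ∑ j ∈ {i}ᶜ, v i j := by
    rw [two_mul_sum_sum_Ioi W fun i j => by simp only [W, abs_sub_comm (y i)], ← hsq,
      ← Finset.sum_sub_distrib]
    refine Finset.sum_congr rfl fun i _ => ?_
    rw [← Finset.sum_sub_distrib]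
    refine Finset.sum_congr rfl fun j _ => ?_
    simp only [W, v]
    ring
  have hmom : ∑ i, y i ^ 2 ≤ 4 * J * N := by
    have h1 : (N - 1) * ∑ i, y i ^ 2 ≤ 2 * (J * (N : ℝ) ^ 2) := by
      calc (N - 1) * ∑ i, y i ^ 2 = ∑ i, ∑ j ∈ {i}ᶜ, ((y i ^ 2 + y j ^ 2) / 2 + 0) := by
            rw [hsq]; ring
        _ ≤ ∑ i, ∑ j ∈ {i}ᶜ, 2 * v i j := Finset.sum_le_sum fun i _ =>
            Finset.sum_le_sum fun j _ => by linarith [hv i j]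
        _ = 2 * ∑ i, ∑ j ∈ {i}ᶜ, v i j := by simp only [Finset.mul_sum]
        _ ≤ _ := by gcongr
    have h2 : (N : ℝ) / 2 * ∑ i, y i ^ 2 ≤ (N - 1) * ∑ i, y i ^ 2 := by
      gcongr
      linarith
    nlinarith
  rw [hprod, ← Real.exp_add, ← Real.exp_add]
  apply Real.exp_le_exp.2
  nlinarith

/-! ### Sampling good configurations -/

/-- Almost sure weak convergence of the empirical measures of an i.i.d. sample. -/
theorem ae_eventually_empiricalMeasure_mem (μ : ProbabilityMeasure ℝ)
    {O : Set (ProbabilityMeasure ℝ)} (hO : O ∈ 𝓝 μ) :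
    ∀ᵐ ω ∂(Measure.infinitePi fun _ : ℕ => (μ : Measure ℝ)), ∀ᶠ N : ℕ+ in atTop,
      empiricalMeasure N (fun i => ω i) ∈ O := by
  let P := Measure.infinitePi fun _ : ℕ => (μ : Measure ℝ)
  -- Weak convergence is tested on one bounded continuous function at a time along any filter, in
  -- particular along "for almost every `ω`, for all large `N`".
  suffices h : Tendsto (fun p : (ℕ → ℝ) × ℕ+ => empiricalMeasure p.2 fun i => p.1 i)
      ((ae P).curry atTop) (𝓝 μ) from
    eventually_curry_iff.1 (h.eventually_mem hO)
  refine ProbabilityMeasure.tendsto_iff_forall_integral_tendsto.2 fun f => ?_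
  have hindep : Pairwise fun i j : ℕ =>
      ProbabilityTheory.IndepFun (fun ω : ℕ → ℝ => f (ω i)) (fun ω => f (ω j)) P :=
    fun i j hij => (ProbabilityTheory.iIndepFun_infinitePi (X := fun _ : ℕ => f)
      fun _ => f.continuous.measurable).indepFun hij
  have hmp : ∀ i : ℕ, MeasurePreserving (fun ω : ℕ → ℝ => ω i) P (μ : Measure ℝ) :=
    fun i => measurePreserving_eval_infinitePi _ i
  have hident : ∀ i : ℕ,
      ProbabilityTheory.IdentDistrib (fun ω : ℕ → ℝ => f (ω i)) (fun ω => f (ω 0)) P P := fun i =>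
    (ProbabilityTheory.IdentDistrib.mk (hmp i).measurable.aemeasurable
      (hmp 0).measurable.aemeasurable ((hmp i).map_eq.trans (hmp 0).map_eq.symm)).comp
        f.continuous.measurable
  have hslln := ProbabilityTheory.strong_law_ae_real (μ := P) (fun i ω => f (ω i))
    ((hmp 0).integrable_comp_of_integrable (f.integrable _)) hindep hident
  have hmean : ∫ ω, f (ω 0) ∂P = ∫ x, f x ∂(μ : Measure ℝ) := by
    rw [← (hmp 0).map_eq, integral_map (hmp 0).measurable.aemeasurable
      f.continuous.aestronglyMeasurable]
  rw [hmean] at hslln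
  intro s hs
  refine mem_map.2 (mem_curry_iff.2 ?_)
  filter_upwards [hslln] with ω hω
  filter_upwards [(hω.comp tendsto_PNat_val_atTop_atTop) hs] with N hN
  have h1 : ∫ x, f x ∂(empiricalMeasure N (fun i => ω i) : Measure ℝ) =
      (∑ i ∈ Finset.range N, f (ω i)) / ((N : ℕ) : ℝ) := by
    simp only [empiricalMeasure, ProbabilityMeasure.coe_mk]
    rw [integral_smul_measure, integral_finsetSum_measure (fun i _ => f.integrable _),
      Finset.sum_range fun i => f (ω i)]
    simp [div_eq_inv_mul]
  simp only [Set.mem_preimage, h1]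
  exact hN

theorem lintegral_sum_shiftedInteraction_le {β : ℝ} (hβ : 0 < β) (μ : ProbabilityMeasure ℝ)
    (N : ℕ) :
    ∫⁻ ω, ∑ i : Fin N, ∑ j ∈ {i}ᶜ, shiftedInteraction β (ω i, ω j)
      ∂(Measure.infinitePi fun _ : ℕ => (μ : Measure ℝ)) ≤ N ^ 2 * shiftedEnergy β μ := by
  have hm : ∀ i j : Fin N, Measurable fun ω : ℕ → ℝ => shiftedInteraction β (ω i, ω j) :=
    fun i j => (measurable_shiftedInteraction hβ).comp (by fun_prop)
  have hterm : ∀ i j : Fin N, i ≠ j → ∫⁻ ω, shiftedInteraction β (ω i, ω j)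
      ∂(Measure.infinitePi fun _ : ℕ => (μ : Measure ℝ)) = shiftedEnergy β μ := by
    intro i j hij
    have := Measure.infinitePi_map_eval_prod (P := fun _ : ℕ => (μ : Measure ℝ))
      (i := (i : ℕ)) (j := (j : ℕ)) (by simpa [Fin.ext_iff] using hij)
    rw [shiftedEnergy, ← this, lintegral_map (measurable_shiftedInteraction hβ) (by fun_prop)]
  rw [lintegral_finsetSum _ fun i _ => Finset.measurable_sum _ fun j _ => hm i j]
  calc ∑ i : Fin N, ∫⁻ ω, ∑ j ∈ {i}ᶜ, shiftedInteraction β (ω i, ω j)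
        ∂(Measure.infinitePi fun _ : ℕ => (μ : Measure ℝ))
      ≤ ∑ i : Fin N, ∑ j : Fin N, shiftedEnergy β μ := by
        refine Finset.sum_le_sum fun i _ => ?_
        rw [lintegral_finsetSum _ fun j _ => hm i j]
        rw [Finset.sum_congr rfl fun j hj => hterm i j (by simpa [eq_comm] using hj)]
        exact Finset.sum_le_sum_of_subset (Finset.subset_univ _)
    _ = _ := by simp [sq, mul_assoc]

/-- Near any `μ` there are configurations whose off-diagonal energy is asymptotically at most that
of `μ`: an i.i.d. sample of `μ` has the right mean energy, and is close to `μ` with probability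
tending to one. -/
theorem eventually_exists_configuration {β : ℝ} (hβ : 0 < β) {μ : ProbabilityMeasure ℝ}
    {O : Set (ProbabilityMeasure ℝ)} (hO : IsOpen O) (hμ : μ ∈ O) {J : ℝ}
    (hJ : shiftedEnergy β μ < ENNReal.ofReal J) :
    ∀ᶠ N : ℕ+ in atTop, ∃ y : Fin N → ℝ, empiricalMeasure N y ∈ O ∧
      ∑ i, ∑ j ∈ {i}ᶜ, shiftedInteraction β (y i, y j) ≤ ENNReal.ofReal (J * (N : ℝ) ^ 2) := by
  let P := Measure.infinitePi fun _ : ℕ => (μ : Measure ℝ)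
  let A : ℕ+ → Set (ℕ → ℝ) := fun N => {ω | empiricalMeasure N (fun i => ω i) ∈ O}
  have hA : ∀ N, MeasurableSet (A N) := fun N =>
    (hO.preimage ((continuous_empiricalMeasure N).comp (by fun_prop))).measurableSet
  have hlim : Tendsto (fun N => P (A N)) atTop (𝓝 1) := by
    have := tendsto_measure_of_ae_tendsto_indicator_of_isFiniteMeasure (μ := P) (L := atTop)
      (A := Set.univ) MeasurableSet.univ hA (by
        filter_upwards [ae_eventually_empiricalMeasure_mem μ (hO.mem_nhds hμ)] with ω hω
        filter_upwards [hω] with N hN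
        simpa [A] using hN)
    simpa using this
  have hlim' : Tendsto (fun N => ENNReal.ofReal J * P (A N)) atTop (𝓝 (ENNReal.ofReal J)) := by
    simpa using ENNReal.Tendsto.const_mul hlim (Or.inr ENNReal.ofReal_ne_top)
  filter_upwards [hlim'.eventually (lt_mem_nhds hJ)] with N hN
  -- Otherwise the energy of the sample exceeds `J N²` on an event of probability close to one,
  -- which contradicts the bound on its mean.
  by_contra! hcon
  have hN0 : ((N : ℕ) : ENNReal) ^ 2 ≠ 0 := by simp
  have h1 : ENNReal.ofReal (J * (N : ℝ) ^ 2) = (N : ℕ) ^ 2 * ENNReal.ofReal J := by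
    rw [mul_comm, ENNReal.ofReal_mul (by positivity), ENNReal.ofReal_pow (by positivity),
      ENNReal.ofReal_natCast]
  have h2 : ((N : ℕ) : ENNReal) ^ 2 * (ENNReal.ofReal J * P (A N)) ≤
      (N : ℕ) ^ 2 * shiftedEnergy β μ := by
    calc ((N : ℕ) : ENNReal) ^ 2 * (ENNReal.ofReal J * P (A N))
        = ∫⁻ _ in A N, ENNReal.ofReal (J * (N : ℝ) ^ 2) ∂P := by
          rw [setLIntegral_const, h1, mul_assoc]
      _ ≤ ∫⁻ ω in A N, ∑ i : Fin N, ∑ j ∈ {i}ᶜ, shiftedInteraction β (ω i, ω j) ∂P :=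
          setLIntegral_mono' (hA N) fun ω hω => (hcon _ hω).le
      _ ≤ ∫⁻ ω, ∑ i : Fin N, ∑ j ∈ {i}ᶜ, shiftedInteraction β (ω i, ω j) ∂P :=
          lintegral_mono' Measure.restrict_le_self le_rfl
      _ ≤ _ := lintegral_sum_shiftedInteraction_le hβ μ N
  exact hN.not_ge ((ENNReal.mul_le_mul_iff_right hN0 (by simp)).1 h2)

/-- Moving the points by at most `δ` moves the empirical measure by at most `δ` in the
Lévy–Prokhorov distance. -/
theorem levyProkhorovDist_empiricalMeasure_le (N : ℕ+) {x y : Fin N → ℝ} {δ : ℝ}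
    (h : ∀ i, |x i - y i| ≤ δ) :
    levyProkhorovDist (empiricalMeasure N x : Measure ℝ) (empiricalMeasure N y) ≤ δ := by
  have hδ : 0 ≤ δ := (abs_nonneg _).trans (h ⟨0, N.pos⟩)
  refine levyProkhorovDist_le_of_forall_le _ _ hδ fun ε B hε hB => ?_
  refine le_add_right ?_
  have key : ∀ (z : Fin N → ℝ) {S : Set ℝ}, MeasurableSet S →
      (empiricalMeasure N z : Measure ℝ) S =
        ((N : ℕ) : ENNReal)⁻¹ * ∑ i, S.indicator 1 (z i) := by
    intro z S hS
    simp [empiricalMeasure, Measure.finsetSum_apply, hS]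
  rw [key x hB, key y Metric.isOpen_thickening.measurableSet]
  gcongr with i
  by_cases hi : x i ∈ B
  · have : y i ∈ Metric.thickening ε B := Metric.mem_thickening_iff.2
      ⟨x i, hi, by rw [Real.dist_eq, abs_sub_comm]; exact (h i).trans_lt hε⟩
    simp [hi, this]
  · simp [hi]

/-- Displacements of size `1 / N` do not affect membership of the empirical measure in an open set,
up to shrinking that set. -/
theorem exists_isOpen_forall_empiricalMeasure_mem {μ : ProbabilityMeasure ℝ}
    {O : Set (ProbabilityMeasure ℝ)} (hO : IsOpen O) (hμ : μ ∈ O) :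
    ∃ O', IsOpen O' ∧ μ ∈ O' ∧ ∀ᶠ N : ℕ+ in atTop, ∀ x y : Fin N → ℝ,
      empiricalMeasure N y ∈ O' → (∀ i, |x i - y i| ≤ 1 / (N : ℝ)) →
        empiricalMeasure N x ∈ O := by
  let e := LevyProkhorov.probabilityMeasureHomeomorph (Ω := ℝ)
  have hopen : IsOpen (e.symm ⁻¹' O) := hO.preimage e.symm.continuous
  obtain ⟨ε, hε, hball⟩ := Metric.isOpen_iff.1 hopen (e μ) (by simpa using hμ)
  refine ⟨e ⁻¹' Metric.ball (e μ) (ε / 2), Metric.isOpen_ball.preimage e.continuous, by simpa,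
    ?_⟩
  have hlim : Tendsto (fun N : ℕ+ => 1 / (N : ℝ)) atTop (𝓝 0) :=
    (tendsto_one_div_atTop_nhds_zero_nat (𝕜 := ℝ)).comp tendsto_PNat_val_atTop_atTop
  filter_upwards [hlim.eventually (gt_mem_nhds (half_pos hε))] with N hN x y hy hxy
  have h1 : dist (e (empiricalMeasure N x)) (e (empiricalMeasure N y)) ≤ 1 / (N : ℝ) :=
    levyProkhorovDist_empiricalMeasure_le N hxy
  have h2 : e (empiricalMeasure N x) ∈ Metric.ball (e μ) ε := by
    rw [Metric.mem_ball]
    have := Metric.mem_ball.1 hy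
    linarith [dist_triangle (e (empiricalMeasure N x)) (e (empiricalMeasure N y)) (e μ)]
  simpa using hball h2

/-! ### The rate function -/

/-- The strict form holds for all real `a`, including those below `-β²`, where both sides fail. -/
theorem energy_lt_coe_iff {β : ℝ} (hβ : 0 < β) {μ : ProbabilityMeasure ℝ} {a : ℝ} :
    energy β μ < a ↔ shiftedEnergy β μ < ENNReal.ofReal (2 * a + 2 * β ^ 2) := by
  rw [energy_eq hβ]
  generalize shiftedEnergy β μ = J
  induction J with
  | top =>
    rw [EReal.coe_ennreal_top, EReal.top_sub_coe, EReal.coe_mul_top_of_pos (by norm_num)]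
    simp
  | coe J =>
    have h1 : ((J : ENNReal) : EReal) = ((J : ℝ) : EReal) := rfl
    rw [h1, ← EReal.coe_sub, ← EReal.coe_mul, EReal.coe_lt_coe_iff,
      ENNReal.lt_ofReal_iff_toReal_lt ENNReal.coe_ne_top, ENNReal.coe_toReal]
    constructor <;> intro h <;> linarith

/-- For `a < -β²` the truncation in `ENNReal.ofReal` is harmless: both sides hold. -/
theorem coe_le_energy_iff {β : ℝ} (hβ : 0 < β) {μ : ProbabilityMeasure ℝ} {a : ℝ} :
    (a : EReal) ≤ energy β μ ↔ ENNReal.ofReal (2 * a + 2 * β ^ 2) ≤ shiftedEnergy β μ := by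
  rw [← not_lt, energy_lt_coe_iff hβ, not_lt]

theorem neg_sq_le_energy {β : ℝ} (hβ : 0 < β) (μ : ProbabilityMeasure ℝ) :
    ((-β ^ 2 : ℝ) : EReal) ≤ energy β μ := by
  rw [coe_le_energy_iff hβ]
  ring_nf
  simp

theorem lowerSemicontinuous_energy {β : ℝ} (hβ : 0 < β) : LowerSemicontinuous (energy β) := by
  intro μ y hy
  obtain ⟨b, hyb, hb⟩ := EReal.lt_iff_exists_real_btwn.1 hy
  obtain ⟨a, hya, ha⟩ := EReal.lt_iff_exists_real_btwn.1 hyb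
  have hab : a < b := EReal.coe_lt_coe_iff.1 ha
  rcases le_or_gt (2 * b + 2 * β ^ 2) 0 with h0 | h0
  · refine Eventually.of_forall fun ν => hyb.trans_le ?_
    rw [coe_le_energy_iff hβ, ENNReal.ofReal_of_nonpos h0]
    exact zero_le
  · have h1 : ENNReal.ofReal (2 * a + 2 * β ^ 2) < shiftedEnergy β μ :=
      ((ENNReal.ofReal_lt_ofReal_iff h0).2 (by linarith)).trans_le
        ((coe_le_energy_iff hβ).1 hb.le)
    filter_upwards [lowerSemicontinuous_shiftedEnergy hβ μ _ h1] with ν hν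
    exact hya.trans_le ((coe_le_energy_iff hβ).2 hν.le)

theorem isCompact_setOf_energy_le {β : ℝ} (hβ : 0 < β) (a : ℝ) :
    IsCompact {μ | energy β μ ≤ a} := by
  refine (isCompact_setOf_shiftedEnergy_le hβ
    (A := ENNReal.ofReal (2 * (a + 1) + 2 * β ^ 2)) ENNReal.ofReal_ne_top).of_isClosed_subset
    ((lowerSemicontinuous_energy hβ).isClosed_preimage _) fun μ hμ => ?_
  refine ((energy_lt_coe_iff hβ).1 (lt_of_le_of_lt hμ ?_)).le
  exact EReal.coe_lt_coe_iff.2 (by linarith)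

theorem exists_iInf_energy_eq {β : ℝ} (hβ : 0 < β) :
    ∃ h : ℝ, ⨅ ν : ProbabilityMeasure ℝ, energy β ν = h := by
  obtain ⟨μ, hμ⟩ := exists_shiftedEnergy_ne_top hβ
  have h1 : ⨅ ν : ProbabilityMeasure ℝ, energy β ν ≠ ⊤ := by
    intro htop
    have h2 : energy β μ < (((shiftedEnergy β μ).toReal + 1 : ℝ) : EReal) := by
      rw [energy_lt_coe_iff hβ, ENNReal.lt_ofReal_iff_toReal_lt hμ]
      nlinarith [sq_nonneg β, (shiftedEnergy β μ).toReal_nonneg]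
    exact (h2.trans_le le_top).ne (top_le_iff.1 (htop ▸ iInf_le _ μ))
  have h2 : ⨅ ν : ProbabilityMeasure ℝ, energy β ν ≠ ⊥ := fun hbot =>
    EReal.coe_ne_bot _ (le_bot_iff.1 (hbot ▸ le_iInf (neg_sq_le_energy hβ)))
  exact ⟨_, (EReal.coe_toReal h1 h2).symm⟩

theorem lt_rateFunction_iff {β h : ℝ} (hh : ⨅ ν : ProbabilityMeasure ℝ, energy β ν = h)
    {μ : ProbabilityMeasure ℝ} {a : ℝ} :
    (a : EReal) < rateFunction β μ ↔ ((a + h : ℝ) : EReal) < energy β μ := by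
  rw [rateFunction, hh, EReal.lt_sub_iff_add_lt (Or.inl (EReal.coe_ne_bot _))
    (Or.inl (EReal.coe_ne_top _)), EReal.coe_add]

theorem rateFunction_le_iff {β h : ℝ} (hh : ⨅ ν : ProbabilityMeasure ℝ, energy β ν = h)
    {μ : ProbabilityMeasure ℝ} {a : ℝ} :
    rateFunction β μ ≤ a ↔ energy β μ ≤ ((a + h : ℝ) : EReal) := by
  rw [← not_lt, lt_rateFunction_iff hh, not_lt]

theorem rateFunction_lt_iff {β h : ℝ} (hh : ⨅ ν : ProbabilityMeasure ℝ, energy β ν = h)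
    {μ : ProbabilityMeasure ℝ} {a : ℝ} :
    rateFunction β μ < a ↔ energy β μ < ((a + h : ℝ) : EReal) := by
  rw [rateFunction, hh, EReal.sub_lt_iff (Or.inl (EReal.coe_ne_bot _))
    (Or.inl (EReal.coe_ne_top _)), EReal.coe_add]

theorem isGoodRateFunction_rateFunction {β : ℝ} (hβ : 0 < β) :
    LargeDeviations.IsGoodRateFunction (rateFunction β) := by
  obtain ⟨h, hh⟩ := exists_iInf_energy_eq hβ
  refine ⟨fun μ hμ => ?_, fun μ y hy => ?_, fun M => ?_⟩
  · have h1 := (rateFunction_lt_iff hh (a := -β ^ 2 - h)).1 (hμ ▸ EReal.bot_lt_coe _)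
    rw [sub_add_cancel] at h1
    exact h1.not_ge (neg_sq_le_energy hβ μ)
  · obtain ⟨a, hya, ha⟩ := EReal.lt_iff_exists_real_btwn.1 hy
    filter_upwards [lowerSemicontinuous_energy hβ μ _ ((lt_rateFunction_iff hh).1 ha)] with ν hν
    exact hya.trans ((lt_rateFunction_iff hh).2 hν)
  · simp only [rateFunction_le_iff hh]
    exact isCompact_setOf_energy_le hβ _

/-! ### Asymptotics of the unnormalized measures -/

/-- Errors that are `o(n²)` are absorbed by an arbitrarily small change of the rate. -/
theorem eventually_le_mul_sq {f : ℕ → ℝ} (hf : f =o[atTop] fun n : ℕ => (n : ℝ) ^ 2) {ε : ℝ}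
    (hε : 0 < ε) : ∀ᶠ N : ℕ+ in atTop, f N ≤ ε * (N : ℝ) ^ 2 := by
  filter_upwards [tendsto_PNat_val_atTop_atTop.eventually (hf.def hε)] with N hN
  refine (le_abs_self _).trans ?_
  simpa using hN

theorem isLittleO_const_mul_natCast_sq (c : ℝ) :
    (fun n : ℕ => c * (n : ℝ)) =o[atTop] fun n : ℕ => (n : ℝ) ^ 2 := by
  have h := (Asymptotics.isLittleO_pow_pow_atTop_of_lt (𝕜 := ℝ) one_lt_two).comp_tendsto
    tendsto_natCast_atTop_atTop
  simpa [Function.comp_def] using h.const_mul_left c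

theorem isLittleO_natCast_mul_log_sq :
    (fun n : ℕ => (n : ℝ) * Real.log n) =o[atTop] fun n : ℕ => (n : ℝ) ^ 2 := by
  have h := Real.isLittleO_log_id_atTop.comp_tendsto tendsto_natCast_atTop_atTop
  simpa [sq, Function.comp_def] using
    (Asymptotics.isBigO_refl (fun n : ℕ => (n : ℝ)) atTop).mul_isLittleO h

theorem eventually_exp_le_unnormalizedMeasure {β : ℝ} (hβ : 0 < β)
    {O : Set (ProbabilityMeasure ℝ)} (hO : IsOpen O) {μ : ProbabilityMeasure ℝ} (hμ : μ ∈ O)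
    {a : ℝ} (ha : energy β μ < a) :
    ∀ᶠ N : ℕ+ in atTop, ENNReal.ofReal (Real.exp (-a * (N : ℝ) ^ 2)) ≤
      unnormalizedMeasure β N (empiricalMeasure N ⁻¹' O) := by
  obtain ⟨b, hb, hba⟩ := EReal.lt_iff_exists_real_btwn.1 ha
  have hba : b < a := EReal.coe_lt_coe_iff.1 hba
  rw [energy_lt_coe_iff hβ] at hb
  have hJ0 : 0 ≤ 2 * b + 2 * β ^ 2 := (ENNReal.ofReal_pos.1 (zero_le.trans_lt hb)).le
  set J := 2 * b + 2 * β ^ 2 with hJ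
  obtain ⟨O', hO', hμ', hmove⟩ := exists_isOpen_forall_empiricalMeasure_mem hO hμ
  have herr : (fun n : ℕ => 2 * ((n : ℝ) * Real.log n) + (β ^ 2 + 4 * J + 1) * n) =o[atTop]
      fun n : ℕ => (n : ℝ) ^ 2 :=
    (isLittleO_natCast_mul_log_sq.const_mul_left 2).add (isLittleO_const_mul_natCast_sq _)
  filter_upwards [hmove, eventually_exists_configuration hβ hO' hμ' hb, eventually_ge_atTop 2,
    eventually_le_mul_sq herr (sub_pos.2 hba)] with N h1 ⟨y, hyO, hy⟩ hN2 h3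
  refine le_trans (ENNReal.ofReal_le_ofReal (Real.exp_le_exp.2 ?_))
    (exp_le_unnormalizedMeasure hβ hN2 (S := empiricalMeasure N ⁻¹' O)
      (fun x hx => h1 x y hyO hx) hJ0 hy)
  have h4 : -(1 / 2) * J + β ^ 2 = -b := by rw [hJ]; ring
  rw [h4]
  linarith

theorem eventually_unnormalizedMeasure_le_exp {β : ℝ} (hβ : 0 < β)
    {F : Set (ProbabilityMeasure ℝ)} (hF : IsClosed F) {a : ℝ}
    (ha : ∀ μ ∈ F, (a : EReal) ≤ energy β μ) {b : ℝ} (hb : b < a) :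
    ∀ᶠ N : ℕ+ in atTop, unnormalizedMeasure β N (empiricalMeasure N ⁻¹' F) ≤
      ENNReal.ofReal (Real.exp (-b * (N : ℝ) ^ 2)) := by
  obtain ⟨c, hbc, hca⟩ := exists_between hb
  have hm : ∃ m, ∀ μ ∈ F, ENNReal.ofReal (2 * c + 2 * β ^ 2) ≤ truncatedEnergy β m μ := by
    rcases le_or_gt (2 * a + 2 * β ^ 2) 0 with h0 | h0
    -- at or below the trivial bound `-β²` there is nothing to prove, and no strict inequality for
    -- the truncation lemma
    · refine ⟨0, fun μ _ => ?_⟩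
      rw [ENNReal.ofReal_of_nonpos (by linarith)]
      exact zero_le
    · obtain ⟨m, hm⟩ := exists_forall_lt_truncatedEnergy hβ hF
        (A := ENNReal.ofReal (2 * c + 2 * β ^ 2)) ENNReal.ofReal_ne_top fun μ hμ =>
          ((ENNReal.ofReal_lt_ofReal_iff h0).2 (by linarith)).trans_le
            ((coe_le_energy_iff hβ).1 (ha μ hμ))
      exact ⟨m, fun μ hμ => (hm μ hμ).le⟩
  obtain ⟨m, hm⟩ := hm
  filter_upwards [eventually_le_mul_sq
    (isLittleO_const_mul_natCast_sq ((m : ℝ) / 2 + Real.log gaussianMass)) (sub_pos.2 hbc)]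
    with N hN
  refine (unnormalizedMeasure_le hβ m N hF hm).trans
    (ENNReal.ofReal_le_ofReal (Real.exp_le_exp.2 ?_))
  linarith

/-! ### The normalized laws -/

theorem partitionFunction_ne_zero {β : ℝ} (hβ : 0 < β) (N : ℕ+) : partitionFunction β N ≠ 0 :=
  (unnormalizedMeasure_univ_pos hβ N).ne'

theorem partitionFunction_ne_top {β : ℝ} (hβ : 0 < β) (N : ℕ+) : partitionFunction β N ≠ ⊤ := by
  have := unnormalizedMeasure_le hβ 0 N isClosed_univ (A := 0) (by simp)
  exact (this.trans_lt ENNReal.ofReal_lt_top).ne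

theorem measurable_empiricalMeasure (N : ℕ+) :
    @Measurable _ _ _ (borel (ProbabilityMeasure ℝ)) (empiricalMeasure N) :=
  @Continuous.measurable _ _ _ _ _ _ (borel _) (@BorelSpace.mk _ _ (borel _) rfl)
    _ (continuous_empiricalMeasure N)

theorem isProbabilityMeasure_law {β : ℝ} (hβ : 0 < β) (N : ℕ+) :
    @IsProbabilityMeasure _ (borel (ProbabilityMeasure ℝ)) (law β N) := by
  have : IsProbabilityMeasure (ensemble β N) := ⟨by
    rw [ensemble, Measure.smul_apply, smul_eq_mul]
    exact ENNReal.inv_mul_cancel (partitionFunction_ne_zero hβ N)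
      (partitionFunction_ne_top hβ N)⟩
  exact @Measure.isProbabilityMeasure_map _ _ _ (borel _) _ this _
    (@Measurable.aemeasurable _ _ _ (borel _) _ _ (measurable_empiricalMeasure N))

theorem law_apply {β : ℝ} (N : ℕ+) {S : Set (ProbabilityMeasure ℝ)}
    (hS : MeasurableSet[borel (ProbabilityMeasure ℝ)] S) :
    law β N S =
      unnormalizedMeasure β N (empiricalMeasure N ⁻¹' S) / partitionFunction β N := by
  rw [law, @Measure.map_apply _ _ _ (borel _) _ _ (measurable_empiricalMeasure N) _ hS, ensemble,
    Measure.smul_apply, smul_eq_mul, mul_comm, div_eq_mul_inv]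

theorem eventually_exp_le_law {β : ℝ} (hβ : 0 < β) {O : Set (ProbabilityMeasure ℝ)}
    (hO : IsOpen O) {μ : ProbabilityMeasure ℝ} (hμ : μ ∈ O) {a : ℝ} (ha : rateFunction β μ < a) :
    ∀ᶠ N : ℕ+ in atTop, ENNReal.ofReal (Real.exp (-a * (N : ℝ) ^ 2)) ≤ law β N O := by
  obtain ⟨h, hh⟩ := exists_iInf_energy_eq hβ
  obtain ⟨b, hb, hba⟩ := EReal.lt_iff_exists_real_btwn.1 ha
  have hba : b < a := EReal.coe_lt_coe_iff.1 hba
  rw [rateFunction_lt_iff hh] at hb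
  have hZ : ∀ ν ∈ (Set.univ : Set (ProbabilityMeasure ℝ)), (h : EReal) ≤ energy β ν :=
    fun ν _ => hh ▸ iInf_le _ ν
  filter_upwards [eventually_exp_le_unnormalizedMeasure hβ hO hμ hb,
    eventually_unnormalizedMeasure_le_exp hβ isClosed_univ hZ
      (show h - (a - b) < h by linarith)] with N h1 h2
  have hmeas : MeasurableSet[borel (ProbabilityMeasure ℝ)] O :=
    MeasurableSpace.measurableSet_generateFrom hO
  rw [law_apply N hmeas, ENNReal.le_div_iff_mul_le
    (Or.inl (partitionFunction_ne_zero hβ N)) (Or.inl (partitionFunction_ne_top hβ N))]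
  calc _ ≤ ENNReal.ofReal (Real.exp (-a * (N : ℝ) ^ 2)) *
        ENNReal.ofReal (Real.exp (-(h - (a - b)) * (N : ℝ) ^ 2)) := by
        gcongr
        exact h2
    _ = ENNReal.ofReal (Real.exp (-(b + h) * (N : ℝ) ^ 2)) := by
        rw [← ENNReal.ofReal_mul (Real.exp_pos _).le, ← Real.exp_add]
        ring_nf
    _ ≤ _ := h1

theorem eventually_law_le_exp {β : ℝ} (hβ : 0 < β) {F : Set (ProbabilityMeasure ℝ)}
    (hF : IsClosed F) {a : ℝ} (ha : ∀ μ ∈ F, (a : EReal) < rateFunction β μ) {b : ℝ}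
    (hb : b < a) :
    ∀ᶠ N : ℕ+ in atTop, law β N F ≤ ENNReal.ofReal (Real.exp (-b * (N : ℝ) ^ 2)) := by
  obtain ⟨h, hh⟩ := exists_iInf_energy_eq hβ
  obtain ⟨c, hbc, hca⟩ := exists_between hb
  obtain ⟨ν, hν⟩ : ∃ ν, energy β ν < ((h + (c - b) : ℝ) : EReal) := by
    rw [← iInf_lt_iff, hh]
    exact EReal.coe_lt_coe_iff.2 (by linarith)
  filter_upwards [eventually_unnormalizedMeasure_le_exp hβ hF (a := a + h)
      (fun μ hμ => ((lt_rateFunction_iff hh).1 (ha μ hμ)).le) (show c + h < a + h by linarith),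
    eventually_exp_le_unnormalizedMeasure hβ isOpen_univ (Set.mem_univ ν) hν] with N h1 h2
  have hmeas : MeasurableSet[borel (ProbabilityMeasure ℝ)] F :=
    @MeasurableSet.of_compl _ _ (borel _)
      (MeasurableSpace.measurableSet_generateFrom (s := {S | IsOpen S}) hF.isOpen_compl)
  rw [law_apply N hmeas, ENNReal.div_le_iff_le_mul
    (Or.inl (partitionFunction_ne_zero hβ N)) (Or.inl (partitionFunction_ne_top hβ N))]
  calc _ ≤ ENNReal.ofReal (Real.exp (-(c + h) * (N : ℝ) ^ 2)) := h1
    _ = ENNReal.ofReal (Real.exp (-b * (N : ℝ) ^ 2)) *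
        ENNReal.ofReal (Real.exp (-(h + (c - b)) * (N : ℝ) ^ 2)) := by
        rw [← ENNReal.ofReal_mul (Real.exp_pos _).le, ← Real.exp_add]
        ring_nf
    _ ≤ _ := by
        gcongr
        exact h2

theorem inv_sq_mul_log_exp (N : ℕ+) (a : ℝ) :
    (((((N : ℝ) ^ 2)⁻¹ : ℝ)) : EReal) *
      ENNReal.log (ENNReal.ofReal (Real.exp (a * (N : ℝ) ^ 2))) = a := by
  have hN : (0 : ℝ) < N := by exact_mod_cast N.pos
  rw [ENNReal.log_ofReal_of_pos (Real.exp_pos _), Real.log_exp, ← EReal.coe_mul]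
  congr 1
  field_simp

theorem monotone_inv_sq_mul_log (N : ℕ+) :
    Monotone fun p : ENNReal => (((((N : ℝ) ^ 2)⁻¹ : ℝ)) : EReal) * ENNReal.log p :=
  fun _ _ h => mul_le_mul_of_nonneg_left (ENNReal.log_monotone h)
    (EReal.coe_nonneg.2 (by positivity))

theorem neg_rateFunction_le_liminf {β : ℝ} (hβ : 0 < β) {O : Set (ProbabilityMeasure ℝ)}
    (hO : IsOpen O) :
    -(⨅ μ ∈ O, rateFunction β μ) ≤
      liminf (fun N : ℕ+ => (((((N : ℝ) ^ 2)⁻¹ : ℝ)) : EReal) * ENNReal.log (law β N O)) atTop := by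
  rw [EReal.neg_le]
  refine le_iInf₂ fun μ hμ => ?_
  rw [EReal.neg_le]
  refine EReal.ge_of_forall_gt_iff_ge.1 fun c hc => ?_
  have hc' : rateFunction β μ < ((-c : ℝ) : EReal) := by
    rw [EReal.coe_neg]
    exact EReal.lt_neg_comm.1 hc
  refine le_liminf_of_le (by isBoundedDefault) ?_
  filter_upwards [eventually_exp_le_law hβ hO hμ hc'] with N hN
  have := monotone_inv_sq_mul_log N hN
  beta_reduce at this
  rwa [inv_sq_mul_log_exp, neg_neg] at this

theorem limsup_le_neg_rateFunction {β : ℝ} (hβ : 0 < β) {F : Set (ProbabilityMeasure ℝ)}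
    (hF : IsClosed F) :
    limsup (fun N : ℕ+ => (((((N : ℝ) ^ 2)⁻¹ : ℝ)) : EReal) * ENNReal.log (law β N F)) atTop ≤
      -(⨅ μ ∈ F, rateFunction β μ) := by
  refine EReal.le_of_forall_lt_iff_le.1 fun c hc => ?_
  rw [EReal.neg_lt_comm, ← EReal.coe_neg] at hc
  obtain ⟨a, hca, ha⟩ := EReal.lt_iff_exists_real_btwn.1 hc
  refine limsup_le_of_le (by isBoundedDefault) ?_
  filter_upwards [eventually_law_le_exp hβ hF
    (fun μ hμ => ha.trans_le (iInf₂_le μ hμ)) (EReal.coe_lt_coe_iff.1 hca)] with N hN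
  have := monotone_inv_sq_mul_log N hN
  beta_reduce at this
  rwa [inv_sq_mul_log_exp, neg_neg] at this

end BetaHermite

theorem mainTheorem1 (β : ℝ) (hβ : 0 < β) :
    LargeDeviations.SatisfiesLDP (BetaHermite.law β) (fun N : ℕ+ => (N : ℝ) ^ 2)
      (BetaHermite.rateFunction β) where
  isProbabilityMeasure := BetaHermite.isProbabilityMeasure_law hβ
  speed_pos N := by positivity
  speed_tendsto := (tendsto_pow_atTop two_ne_zero).comp
    (tendsto_natCast_atTop_atTop.comp tendsto_PNat_val_atTop_atTop)
  isGoodRateFunction := BetaHermite.isGoodRateFunction_rateFunction hβ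
  bounds E _ := by
    refine ⟨BetaHermite.neg_rateFunction_le_liminf hβ isOpen_interior, ?_,
      BetaHermite.limsup_le_neg_rateFunction hβ isClosed_closure⟩
    refine (liminf_le_liminf (Eventually.of_forall fun N => ?_)).trans (liminf_le_limsup)
    exact BetaHermite.monotone_inv_sq_mul_log N
      (measure_mono (interior_subset.trans subset_closure))
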